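/- Let $G$ be a finite simple directed acyclic graph with vertex set $V$, and for every vertex $x$ fix a word $\mathrm{pa}(x)$ that lists the parents of $x$ without repetition. Let $\mathbf{Cau}(G)$ be the free strict Markov category whose objects are the words over $V$ (monoidal product: concatenation; unit: the empty word) and whose morphisms are generated, besides identities and symmetries, by the duplicates $\delta_x : x \to xx$ and discards $\epsilon_x : x \to \emptyset$ of the letters and one causal mechanism $\kappa_x : \mathrm{pa}(x) \to x$ for each vertex $x$, subject only to the axioms of a Markov category (symmetric strict monoidal category, cocommutative comonoids compatible with $\otimes$, naturality of discards). For words $t, v$ without repeated letters, let $G_{t\to v}$ be the subgraph of $G$ consisting of the vertices in $t$ and $v$ and of all directed paths that end in $v$ and do not pass through or end in $t$ (starting in $t$ is allowed). The causal effect $[v\|t] : t \to v$ is the morphism of $\mathbf{Cau}(G)$ represented by the string diagram with input wires $t$, exactly one mechanism $\kappa_x$ for each vertex $x$ of $G_{t\to v}$ not in $t$, the inputs of each $\kappa_x$ being (duplicates of) the wires of the parents of $x$, and one output wire for each letter of $v$; wires that are not used are discarded. In a Markov category, for $f : Z \to X \otimes Y$, we say that $X$ and $Y$ are conditionally independent given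 $Z$ over $f$ if $$f = (f_X \otimes f_Y)\circ \delta_Z, \qquad f_X = (1_X\otimes \epsilon_Y)\circ f,\quad f_Y = (\epsilon_X \otimes 1_Y)\circ f .$$ For distinct vertices $i, j$ of $G$, a forward trek from $i$ to $j$ is a directed path from $i$ to $j$; a backward trek from $i$ to $j$ is a directed path from $j$ to $i$, or the union of two directed paths from a vertex $k \ne i,j$ to $i$ and to $j$ that have only $k$ in common. For $X, Y \subseteq V$, a trek from $i\in X$ to $j \in Y$ is proper (from $X$ to $Y$) if it contains no vertex of $X \cup Y$ other than $i$ and $j$. The sets $X$ and $Y$ are $t$-separated by $Z \subseteq V$ if every proper forward trek from $X$ to $Y$ contains a vertex of $Z$ (forward-$t$-separation) and every proper backward trek from $X$ to $Y$ contains a vertex of $Z$ (backward-$t$-separation). Theorem. Let $u$, $v$, $w$ be words over $V$ without repeated letters, pairwise having no letter in common. Then $v$ and $w$ are conditionally independent given $u$ over the causal effect $[vw\|u] : u \to v\otimes w$ in $\mathbf{Cau}(G)$ if and only if (the sets of letters of) $v$ and $w$ are $t$-separated by (the set of letters of) $u$ in $G$. -/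

import Mathlib

open CategoryTheory MonoidalCategory ComonObj

universe u

/-! ### Conditional independence in a Markov category -/

/-- For `f : Z ⟶ X ⊗ Y` in a Markov category, `X` and `Y` are conditionally independent given `Z`
over `f`: duplicating `Z` and applying the two marginals of `f` side by side gives back `f`. -/
def CondIndep {C : Type*} [Category C] [MonoidalCategory C] [MarkovCategory C] {X Y Z : C}
    (f : Z ⟶ X ⊗ Y) : Prop :=
  f = Δ[Z] ≫ ((f ≫ X ◁ ε[Y] ≫ (ρ_ X).hom) ⊗ₘ (f ≫ ε[X] ▷ Y ≫ (λ_ Y).hom))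

/-! ### Directed acyclic graphs, directed paths, treks and t-separation -/

/-- A simple directed acyclic graph, together with, for every vertex `x`, a chosen singular word
`pa x` listing the parents of `x`. -/
structure CausalGraph (V : Type u) extends Digraph V where
  acyclic : ∀ x, ¬ Relation.TransGen Adj x x
  pa : V → List V
  nodup_pa : ∀ x, (pa x).Nodup
  mem_pa : ∀ {x y}, x ∈ pa y ↔ Adj x y

namespace CausalGraph

variable {V : Type u} (G : CausalGraph V)

/-- `p` lists the vertices of a directed path (with at least one arrow) from `i` to `j`. As `G` is
simple and acyclic, the arrows of the path are determined by `p` and automatically distinct. -/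
def IsDirectedPath (i j : V) (p : List V) : Prop :=
  2 ≤ p.length ∧ p.IsChain G.Adj ∧ p.head? = some i ∧ p.getLast? = some j

/-- `S` is the set of vertices of a forward trek from `i` to `j`. -/
def IsForwardTrek (i j : V) (S : Set V) : Prop :=
  i ≠ j ∧ ∃ p, G.IsDirectedPath i j p ∧ S = {x | x ∈ p}

/-- `S` is the set of vertices of a backward trek from `i` to `j`: a directed path from `j` to `i`,
or two directed paths from a vertex `k`, distinct from `i` and `j`, to `i` and to `j`, that have
only `k` in common. -/
def IsBackwardTrek (i j : V) (S : Set V) : Prop :=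
  i ≠ j ∧
    ((∃ p, G.IsDirectedPath j i p ∧ S = {x | x ∈ p}) ∨
      ∃ k p q, k ≠ i ∧ k ≠ j ∧ G.IsDirectedPath k i p ∧ G.IsDirectedPath k j q ∧
        (∀ x ∈ p, x ∈ q → x = k) ∧ S = {x | x ∈ p ∨ x ∈ q})

/-- A trek from `i` to `j` with vertex set `S` is proper as a trek from `X` to `Y`. -/
def IsProper (X Y : Set V) (i j : V) (S : Set V) : Prop :=
  i ∈ X ∧ j ∈ Y ∧ ∀ x ∈ S, x ∈ X ∪ Y → x = i ∨ x = j

/-- `X` is forward-t-separated from `Y` by `Z`. -/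
def ForwardTSeparated (X Y Z : Set V) : Prop :=
  ∀ i j S, G.IsForwardTrek i j S → IsProper X Y i j S → ∃ k ∈ S, k ∈ Z

/-- `X` is backward-t-separated from `Y` by `Z`. -/
def BackwardTSeparated (X Y Z : Set V) : Prop :=
  ∀ i j S, G.IsBackwardTrek i j S → IsProper X Y i j S → ∃ k ∈ S, k ∈ Z

/-- `X` and `Y` are t-separated by `Z`. -/
def TSeparated (X Y Z : Set V) : Prop :=
  G.ForwardTSeparated X Y Z ∧ G.BackwardTSeparated X Y Z

/-- The vertices of the subgraph `G_{t → v}`: those of `t` and `v`, and those on the directed paths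
that end in `v` and do not pass through or end in `t` (starting in `t` is allowed). -/
def effectVertices (t v : List V) : Set V :=
  {x | x ∈ t ∨ x ∈ v ∨
    ∃ i j p, G.IsDirectedPath i j p ∧ j ∈ v ∧ (∀ y ∈ p.tail, y ∉ t) ∧ x ∈ p}

/-! ### The causal theory: the free strict Markov category on the causal mechanisms -/

/-- Formal morphisms between words over `V`, written in diagrammatic order. -/
inductive Term : List V → List V → Type u
  | id (a : List V) : Term a a
  | comp {a b c : List V} (f : Term a b) (g : Term b c) : Term a c
  | tensor {a b c d : List V} (f : Term a b) (g : Term c d) : Term (a ++ c) (b ++ d)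
  | swap (a b : List V) : Term (a ++ b) (b ++ a)
  | copy (a : List V) : Term a (a ++ a)
  | discard (a : List V) : Term a []
  | mech (x : V) : Term (G.pa x) [x]

namespace Term

variable {G}

/-- The identity, read along an equality of words. -/
def cast {a b : List V} (h : a = b) : G.Term a b := h ▸ Term.id a

/-- The congruence generated by the axioms of a strict Markov category. Words that are only
propositionally equal (such as `(a ++ b) ++ c` and `a ++ (b ++ c)`) are bridged by letting the
relation compare formal morphisms with different indices; `Rel.index_eq` shows that related
morphisms do have equal domains and equal codomains. -/
inductive Rel : ∀ {a b a' b' : List V}, G.Term a b → G.Term a' b' → Prop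
  -- congruence
  | refl {a b} (f : G.Term a b) : Rel f f
  | symm {a b a' b'} {f : G.Term a b} {g : G.Term a' b'} : Rel f g → Rel g f
  | trans {a b a' b' a'' b''} {f : G.Term a b} {g : G.Term a' b'} {h : G.Term a'' b''} :
      Rel f g → Rel g h → Rel f h
  | comp_congr {a b c a' b' c'} {f : G.Term a b} {g : G.Term b c} {f' : G.Term a' b'}
      {g' : G.Term b' c'} : Rel f f' → Rel g g' → Rel (f.comp g) (f'.comp g')
  | tensor_congr {a b c d a' b' c' d'} {f : G.Term a b} {g : G.Term c d} {f' : G.Term a' b'}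
      {g' : G.Term c' d'} : Rel f f' → Rel g g' → Rel (f.tensor g) (f'.tensor g')
  -- category
  | id_comp {a b} (f : G.Term a b) : Rel ((Term.id a).comp f) f
  | comp_id {a b} (f : G.Term a b) : Rel (f.comp (Term.id b)) f
  | assoc {a b c d} (f : G.Term a b) (g : G.Term b c) (h : G.Term c d) :
      Rel ((f.comp g).comp h) (f.comp (g.comp h))
  -- strict monoidal category
  | tensor_id (a b) : Rel ((Term.id a).tensor (Term.id b)) (Term.id (a ++ b))
  | tensor_comp {a b c a' b' c'} (f : G.Term a b) (g : G.Term b c) (f' : G.Term a' b')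
      (g' : G.Term b' c') :
      Rel ((f.comp g).tensor (f'.comp g')) ((f.tensor f').comp (g.tensor g'))
  | tensor_assoc {a b c a' b' c'} (f : G.Term a a') (g : G.Term b b') (h : G.Term c c') :
      Rel ((f.tensor g).tensor h) (f.tensor (g.tensor h))
  | unit_tensor {a b} (f : G.Term a b) : Rel ((Term.id []).tensor f) f
  | tensor_unit {a b} (f : G.Term a b) : Rel (f.tensor (Term.id [])) f
  -- symmetry
  | swap_natural {a b a' b'} (f : G.Term a a') (g : G.Term b b') :
      Rel ((f.tensor g).comp (swap a' b')) ((swap a b).comp (g.tensor f))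
  | swap_swap (a b) : Rel ((swap a b).comp (swap b a)) (Term.id (a ++ b))
  | swap_append (a b c) :
      Rel (swap a (b ++ c))
        (((swap a b).tensor (Term.id c)).comp
          ((cast (List.append_assoc b a c)).comp ((Term.id b).tensor (swap a c))))
  -- cocommutative comonoids
  | copy_assoc (a) :
      Rel ((copy a).comp ((copy a).tensor (Term.id a)))
        ((copy a).comp ((Term.id a).tensor (copy a)))
  | copy_discard_right (a) : Rel ((copy a).comp ((Term.id a).tensor (discard a))) (Term.id a)
  | copy_discard_left (a) : Rel ((copy a).comp ((discard a).tensor (Term.id a))) (Term.id a)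
  | copy_swap (a) : Rel ((copy a).comp (swap a a)) (copy a)
  -- duplicates and discards respect the monoidal product
  | copy_append (a b) :
      Rel (copy (a ++ b))
        (((copy a).tensor (copy b)).comp
          ((cast (by simp : (a ++ a) ++ (b ++ b) = (a ++ (a ++ b)) ++ b)).comp
            (((Term.id a).tensor (swap a b)).tensor (Term.id b))))
  | discard_append (a b) : Rel (discard (a ++ b)) ((discard a).tensor (discard b))
  -- discarding is natural
  | discard_natural {a b} (f : G.Term a b) : Rel (f.comp (discard b)) (discard a)

namespace Rel

theorem index_eq {a b a' b' : List V} {f : G.Term a b} {g : G.Term a' b'} (h : Rel f g) :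
    a = a' ∧ b = b' := by
  induction h <;> simp_all

theorem cast_id {a b : List V} (h : a = b) : Rel (cast h : G.Term a b) (Term.id a) := by
  subst h; exact refl _

theorem cast_comp {a b c : List V} (h : a = b) (f : G.Term b c) : Rel ((cast h).comp f) f := by
  subst h; exact id_comp f

theorem comp_cast {a b c : List V} (h : b = c) (f : G.Term a b) : Rel (f.comp (cast h)) f := by
  subst h; exact comp_id f

theorem id_congr {a b : List V} (h : a = b) : Rel (Term.id a : G.Term a a) (Term.id b) := by
  subst h; exact refl _

theorem comp_of_left {a b c x : List V} {f : G.Term a b} (h : Rel f (Term.id x : G.Term x x))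
    (g : G.Term b c) : Rel (f.comp g) g := by
  obtain ⟨rfl, rfl⟩ := h.index_eq
  exact (comp_congr h (refl g)).trans (id_comp g)

theorem comp_of_right {a b c x : List V} {g : G.Term b c} (h : Rel g (Term.id x : G.Term x x))
    (f : G.Term a b) : Rel (f.comp g) f := by
  obtain ⟨rfl, rfl⟩ := h.index_eq
  exact (comp_congr (refl f) h).trans (comp_id f)

theorem cast_tensor_id {a b : List V} (h : a = b) (c : List V) :
    Rel ((cast h : G.Term a b).tensor (Term.id c)) (Term.id (a ++ c)) := by
  subst h; exact tensor_id a c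

theorem id_tensor_cast {a b : List V} (h : a = b) (c : List V) :
    Rel ((Term.id c).tensor (cast h : G.Term a b)) (Term.id (c ++ a)) := by
  subst h; exact tensor_id c a

theorem discard_nil : Rel (discard [] : G.Term [] []) (Term.id []) :=
  (discard_natural (copy [])).symm.trans
    ((comp_congr (refl _) (unit_tensor _).symm).trans (copy_discard_right []))

theorem copy_nil : Rel (copy [] : G.Term [] []) (Term.id []) :=
  (comp_id _).symm.trans <| (comp_congr (refl _)
    (discard_nil.symm.trans (tensor_unit (discard [])).symm)).trans (copy_discard_left [])

end Rel

variable (G) in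
/-- Formal morphisms up to the axioms. -/
instance setoid (a b : List V) : Setoid (G.Term a b) :=
  ⟨Rel, Rel.refl, Rel.symm, Rel.trans⟩

end Term

/-- The causal theory `Cau(G)`. Its objects are the words over `V`. -/
def Cau (_ : CausalGraph V) : Type u := List V

/-- A word over `V`, as an object of `Cau(G)`. -/
def word (a : List V) : G.Cau := a

instance : Category.{u} G.Cau where
  Hom a b := Quotient (Term.setoid G a b)
  id a := ⟦Term.id a⟧
  comp := Quotient.map₂ Term.comp fun _ _ h _ _ h' => Term.Rel.comp_congr h h'
  id_comp := by rintro _ _ ⟨f⟩; exact Quotient.sound (Term.Rel.id_comp f)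
  comp_id := by rintro _ _ ⟨f⟩; exact Quotient.sound (Term.Rel.comp_id f)
  assoc := by rintro _ _ _ _ ⟨f⟩ ⟨g⟩ ⟨h⟩; exact Quotient.sound (Term.Rel.assoc f g h)

/-- The identity, read along an equality of words. -/
def castIso {a b : List V} (h : a = b) : G.word a ≅ G.word b where
  hom := Quotient.mk (Term.setoid G a b) (Term.cast h)
  inv := Quotient.mk (Term.setoid G b a) (Term.cast h.symm)
  hom_inv_id := Quotient.sound ((Term.Rel.cast_comp _ _).trans
    ((Term.Rel.cast_id _).trans (Term.Rel.id_congr h.symm)))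
  inv_hom_id := Quotient.sound ((Term.Rel.cast_comp _ _).trans
    ((Term.Rel.cast_id _).trans (Term.Rel.id_congr h)))

instance : MonoidalCategoryStruct G.Cau where
  tensorObj a b := G.word (List.append a b)
  tensorUnit := G.word []
  tensorHom f g := Quotient.map₂ Term.tensor (fun _ _ h _ _ h' => Term.Rel.tensor_congr h h') f g
  whiskerLeft a _ _ f :=
    Quotient.map (Term.tensor (Term.id a)) (fun _ _ h => Term.Rel.tensor_congr (.refl _) h) f
  whiskerRight f b :=
    Quotient.map (fun f => Term.tensor f (Term.id b))
      (fun _ _ h => Term.Rel.tensor_congr h (.refl _)) f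
  associator a b c := G.castIso (List.append_assoc a b c)
  leftUnitor a := G.castIso (List.nil_append a)
  rightUnitor a := G.castIso (List.append_nil a)

theorem append_assoc₄ (a b c d : List V) :
    a ++ ((b ++ c) ++ d) = (a ++ b) ++ (c ++ d) := by simp

theorem append_nil_append (a b : List V) : a ++ ([] ++ b) = (a ++ []) ++ b := by simp

open Term.Rel in
instance : MonoidalCategory G.Cau :=
  MonoidalCategory.ofTensorHom
    (id_tensorHom_id := fun a b => Quotient.sound (tensor_id a b))
    (id_tensorHom := by rintro a _ _ ⟨f⟩; rfl)
    (tensorHom_id := by rintro _ _ ⟨f⟩ b; rfl)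
    (tensorHom_comp_tensorHom := by
      rintro _ _ _ _ _ _ ⟨f⟩ ⟨f'⟩ ⟨g⟩ ⟨g'⟩; exact Quotient.sound (tensor_comp f g f' g').symm)
    (associator_naturality := by
      rintro _ _ _ _ _ _ ⟨f⟩ ⟨g⟩ ⟨h⟩
      exact Quotient.sound <|
        (comp_cast _ _).trans ((tensor_assoc f g h).trans (cast_comp _ _).symm))
    (leftUnitor_naturality := by
      rintro _ _ ⟨f⟩
      exact Quotient.sound <| (comp_cast _ _).trans ((unit_tensor f).trans (cast_comp _ _).symm))
    (rightUnitor_naturality := by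
      rintro _ _ ⟨f⟩
      exact Quotient.sound <| (comp_cast _ _).trans ((tensor_unit f).trans (cast_comp _ _).symm))
    (pentagon := fun a b c d => Quotient.sound <|
      (comp_of_left (cast_tensor_id _ d) _).trans <| (cast_comp _ _).trans <|
        (id_tensor_cast _ a).trans <| (id_congr (append_assoc₄ a b c d)).trans <|
        (cast_id _).symm.trans (cast_comp _ _).symm)
    (triangle := fun a b => Quotient.sound <|
      (cast_comp _ _).trans <| (id_tensor_cast _ a).trans <|
        (id_congr (append_nil_append a b)).trans (cast_tensor_id _ b).symm)

/-- The symmetry of `Cau(G)`. -/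
def swapIso (a b : G.Cau) : a ⊗ b ≅ b ⊗ a where
  hom := Quotient.mk (Term.setoid G _ _) (Term.swap a b)
  inv := Quotient.mk (Term.setoid G _ _) (Term.swap b a)
  hom_inv_id := Quotient.sound (Term.Rel.swap_swap a b)
  inv_hom_id := Quotient.sound (Term.Rel.swap_swap b a)

open Term.Rel in
theorem swapIso_hexagon (a b c : G.Cau) :
    (α_ a b c).hom ≫ (G.swapIso a (b ⊗ c)).hom ≫ (α_ b c a).hom =
      ((G.swapIso a b).hom ▷ c) ≫ (α_ b a c).hom ≫ (b ◁ (G.swapIso a c).hom) :=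
  Quotient.sound <| (cast_comp _ _).trans <| (comp_cast _ _).trans (swap_append a b c)

instance : SymmetricCategory G.Cau where
  braiding := G.swapIso
  braiding_naturality_right := by
    rintro a _ _ ⟨f⟩; exact Quotient.sound (Term.Rel.swap_natural _ _)
  braiding_naturality_left := by
    rintro _ _ ⟨f⟩ a; exact Quotient.sound (Term.Rel.swap_natural _ _)
  hexagon_forward := G.swapIso_hexagon
  hexagon_reverse a b c := by
    have h : α_ c a b ≪≫ G.swapIso c (a ⊗ b) ≪≫ α_ a b c =
        whiskerRightIso (G.swapIso c a) b ≪≫ α_ a c b ≪≫ whiskerLeftIso a (G.swapIso c b) :=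
      Iso.ext (G.swapIso_hexagon c a b)
    simpa [swapIso] using congrArg Iso.inv h
  symmetry a b := (G.swapIso a b).hom_inv_id

open Term.Rel in
/-- Every word carries a duplicate and a discard. -/
@[reducible] def comonObj (a : G.Cau) : ComonObj a where
  counit := Quotient.mk (Term.setoid G _ _) (Term.discard a)
  comul := Quotient.mk (Term.setoid G _ _) (Term.copy a)
  counit_comul := Quotient.sound ((copy_discard_left a).trans (cast_id _).symm)
  comul_counit := Quotient.sound ((copy_discard_right a).trans (cast_id _).symm)
  comul_assoc := Quotient.sound ((copy_assoc a).symm.trans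
    (comp_congr (refl _) (comp_cast _ _).symm))

open Term.Rel in
instance : MarkovCategory G.Cau where
  comonObj := G.comonObj
  isCommComonObj a := letI := G.comonObj a; { comul_comm := Quotient.sound (copy_swap a) }
  copy_tensor a b := by
    unfold tensorμ
    refine Quotient.sound <| (copy_append a b).trans <| comp_congr (refl _) ?_
    refine (cast_comp _ _).trans <| Term.Rel.symm <| (cast_comp _ _).trans ?_
    refine (comp_of_left (id_tensor_cast _ a) _).trans ?_
    refine (comp_of_right ((comp_of_left (id_tensor_cast _ a) _).trans (cast_id _)) _).trans ?_
    exact (tensor_assoc _ _ _).symm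
  discard_tensor a b := Quotient.sound <| (discard_append a b).trans (comp_cast _ _).symm
  copy_unit := Quotient.sound <| copy_nil.trans (cast_id _).symm
  discard_unit := Quotient.sound discard_nil
  discard_natural := by rintro _ _ ⟨f⟩; exact Quotient.sound (discard_natural f)

/-- The causal mechanism `κ_x : pa(x) ⟶ x`. -/
def mechanism (x : V) : G.word (G.pa x) ⟶ G.word [x] :=
  Quotient.mk (Term.setoid G _ _) (Term.mech x)

/-! ### Orders along which a causal effect can be assembled -/

/-- Starting from the wires `s`, the mechanisms of the vertices in `l` can be added one after
another (parents are available when needed), and all of `v` is available in the end. -/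
def CanRun (v : List V) : List V → List V → Prop
  | s, [] => ∀ x ∈ v, x ∈ s
  | s, x :: l => (∀ y ∈ G.pa x, y ∈ s) ∧ CanRun v (x :: s) l

theorem parent_mem_effectVertices {t v : List V} {x y : V} (hx : x ∈ G.effectVertices t v)
    (hxt : x ∉ t) (hyx : G.Adj y x) : y ∈ G.effectVertices t v := by
  rcases hx with hx | hx | ⟨i, j, p, ⟨-, hc, -, hl⟩, hj, ht, hxp⟩
  · exact absurd hx hxt
  · exact Or.inr <| Or.inr ⟨y, x, [y, x], by simp [IsDirectedPath, hyx], hx, by simpa using hxt,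
      by simp⟩
  · obtain ⟨l₁, l₂, rfl⟩ := List.append_of_mem hxp
    refine Or.inr <| Or.inr ⟨y, j, y :: x :: l₂, ⟨by simp, ?_, rfl, ?_⟩, hj, ?_, by simp⟩
    · exact List.isChain_cons_cons.2 ⟨hyx, (List.isChain_append.1 hc).2.1⟩
    · simpa [List.getLast?_append] using hl
    · intro z hz
      rcases List.mem_cons.1 hz with rfl | hz
      · exact hxt
      · exact ht z (by cases l₁ <;> simp [hz])

theorem exists_topological_order [Finite V] (S : Finset V) :
    ∃ l : List V, l.Nodup ∧ (∀ x, x ∈ l ↔ x ∈ S) ∧ l.Pairwise fun a b => ¬ G.Adj b a := by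
  classical
  induction S using Finset.strongInduction with
  | H S ih =>
    rcases S.eq_empty_or_nonempty with rfl | hS
    · exact ⟨[], by simp⟩
    · let r : V → V → Prop := fun a b => Relation.TransGen G.Adj b a
      have : IsTrans V r := ⟨fun a b c h h' => h'.trans h⟩
      have : Std.Irrefl r := ⟨fun a h => G.acyclic a h⟩
      obtain ⟨m, hm, hmin⟩ := (Finite.wellFounded_of_trans_of_irrefl r).has_min (S : Set V) hS
      obtain ⟨l, hn, hl, hp⟩ := ih (S.erase m) (Finset.erase_ssubset hm)
      refine ⟨l ++ [m], ?_, ?_, ?_⟩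
      · simpa [List.nodup_append, hn] using fun a ha e => by simp [hl, e] at ha
      · intro x
        by_cases e : x = m
        · simpa [e] using hm
        · simp [hl, e]
      · refine List.pairwise_append.2 ⟨hp, by simp, fun a ha b hb h => ?_⟩
        obtain rfl : b = m := by simpa using hb
        exact hmin a (by simpa using (Finset.mem_erase.1 ((hl a).1 ha)).2) (.single h)

theorem canRun_of_pairwise (v : List V) : ∀ (s l : List V),
    (∀ x ∈ l, ∀ y, G.Adj y x → y ∈ s ∨ y ∈ l) → l.Pairwise (fun a b => ¬ G.Adj b a) →
    (∀ x ∈ v, x ∈ s ∨ x ∈ l) → G.CanRun v s l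
  | s, [], _, _, hv => fun x hx => by simpa using hv x hx
  | s, x :: l, hl, hp, hv => by
    rw [List.pairwise_cons] at hp
    refine ⟨fun y hy => ?_, canRun_of_pairwise v (x :: s) l (fun z hz y hy => ?_) hp.2
      fun z hz => ?_⟩
    · have hy := G.mem_pa.1 hy
      rcases hl x (by simp) y hy with h | h
      · exact h
      · rcases List.mem_cons.1 h with rfl | h
        · exact absurd (.single hy) (G.acyclic y)
        · exact absurd hy (hp.1 y h)
    · have := hl z (by simp [hz]) y hy
      simp only [List.mem_cons] at this ⊢
      tauto
    · have := hv z hz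
      simp only [List.mem_cons] at this ⊢
      tauto

theorem exists_effect_order [Finite V] (t v : List V) :
    ∃ l : List V, l.Nodup ∧ (∀ x, x ∈ l ↔ x ∈ G.effectVertices t v ∧ x ∉ t) ∧
      G.CanRun v t l := by
  obtain ⟨l, hn, hl, hp⟩ :=
    G.exists_topological_order (Set.toFinite {x | x ∈ G.effectVertices t v ∧ x ∉ t}).toFinset
  simp only [Set.Finite.mem_toFinset, Set.mem_ofPred_eq] at hl
  refine ⟨l, hn, hl, G.canRun_of_pairwise v t l (fun x hx y hy => ?_) hp fun x hx => ?_⟩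
  · have hx := (hl x).1 hx
    by_cases hyt : y ∈ t
    · exact Or.inl hyt
    · exact Or.inr ((hl y).2 ⟨G.parent_mem_effectVertices hx.1 hx.2 hy, hyt⟩)
  · by_cases hxt : x ∈ t
    · exact Or.inl hxt
    · exact Or.inr ((hl x).2 ⟨Or.inr (Or.inl hx), hxt⟩)

/-! ### Multipliers and causal effects -/

section
variable [DecidableEq V]

/-- The multiplier `s ⟶ x` for a letter `x` of `s`: it discards every letter other than (the first
occurrence of) `x`. -/
def proj : (s : List V) → (x : V) → x ∈ s → (G.word s ⟶ G.word [x])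
  | y :: s, x, h =>
    if e : x = y then
      (𝟙 (G.word [y]) ⊗ₘ ε[G.word s] : G.word [y] ⊗ G.word s ⟶ G.word [y] ⊗ 𝟙_ G.Cau) ≫
        (G.castIso (by rw [e]; rfl : [y] ++ [] = [x])).hom
    else
      (ε[G.word [y]] ⊗ₘ proj s x (by simpa [e] using h) :
        G.word [y] ⊗ G.word s ⟶ 𝟙_ G.Cau ⊗ G.word [x])

/-- The multiplier `ι_{s → w}`, built from duplicates, discards and identities, that produces the
word `w` out of the word `s`, where all letters of `w` occur in `s`. (It is the unique one when `s`
is singular.) -/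
def multiplier (s : List V) : (w : List V) → (∀ x ∈ w, x ∈ s) → (G.word s ⟶ G.word w)
  | [], _ => ε[G.word s]
  | x :: w, h =>
    (Δ[G.word s] ≫ (G.proj s x (h x (by simp)) ⊗ₘ multiplier s w fun y hy => h y (by simp [hy])) :
      G.word s ⟶ G.word [x] ⊗ G.word w)

/-- Given wires `s` that include all the parents of `x`, the morphism that duplicates them, feeds
the parents of `x` into the mechanism `κ_x`, and adds the outcome as a new wire. -/
def addMechanism (s : List V) (x : V) (h : ∀ y ∈ G.pa x, y ∈ s) : G.word s ⟶ G.word (x :: s) :=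
  (Δ[G.word s] ≫ ((G.multiplier s (G.pa x) h ≫ G.mechanism x) ⊗ₘ 𝟙 (G.word s)) :
    G.word s ⟶ G.word [x] ⊗ G.word s)

/-- The morphism that adds the mechanisms of the vertices in `l` one after another and finally
outputs `v`. -/
def run (v : List V) : (s l : List V) → G.CanRun v s l → (G.word s ⟶ G.word v)
  | s, [], h => G.multiplier s v h
  | s, x :: l, h => G.addMechanism s x h.1 ≫ run v (x :: s) l h.2

/-- The causal effect `[v ‖ t] : t ⟶ v`, for singular words `t` and `v`: the morphism whose string
diagram has the wires `t` as inputs, exactly one mechanism `κ_x` for each vertex `x ∉ t` of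
`G_{t → v}`, every input wire of `κ_x` connected to the wire of the parent in question, and one
output for each letter of `v`. The diagram is assembled along an order of the vertices in which
parents come first; copies of wires that are not needed are discarded, which by counitality does
not change the morphism. -/
noncomputable def causalEffect [Finite V] (t v : List V) : G.word t ⟶ G.word v :=
  G.run v t (G.exists_effect_order t v).choose (G.exists_effect_order t v).choose_spec.2.2

end

end CausalGraph

/-! ### Pairing in Markov categories -/

namespace CategoryTheory.MarkovCategory

open CopyDiscardCategory

variable {C : Type*} [Category C] [MonoidalCategory C] [MarkovCategory C]

/-! Both sides are compared with a third condition (`tSeparated_iff`): no vertex outside `u` reaches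
both `v` and `w` along directed paths that avoid `u` after their start. A trek missing `u` has such
a common source; conversely, two paths from a common source, of least total length, form a proper
trek missing `u`.

If there is no common source, let `A` and `B` be the sets of vertices that reach `v` and `w`. Both
are closed under parents at each mechanism of the effect, and no mechanism belongs to both. Each
mechanism therefore serves at most one of the two outputs: it is absorbed into that component of a
pairing and vanishes from the other by naturality of discards (`run_append_eq_pair`). Mechanisms are
never duplicated in this argument; only duplicates, discards and permutations of wires, which are
copyable, are moved through copies. A pairing is conditionally independent because its components
are its marginals.

If `x` is a common source, two morphisms of a free category have to be told apart, and this needs an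
invariant. Every formal morphism denotes a total relation between lists of values, and the Markov
axioms hold for total relations (`Term.Rel.sem_iff`). In `sourceModel x` the vertex `x` takes any
Boolean value and all others take the disjunction of their parents. With input `false` throughout,
both the zero output and the output caused by `x = true` occur; conditional independence would allow
the second on `v` to be combined with the first on `w`, which `not_condIndep_run` refutes. -/

/-- Duplicate the input and apply `f` and `g` side by side. -/
def pair {X Y Z : C} (f : X ⟶ Y) (g : X ⟶ Z) : X ⟶ Y ⊗ Z := Δ[X] ≫ (f ⊗ₘ g)

/-- Discard the second factor. -/
def fst (X Y : C) : X ⊗ Y ⟶ X := X ◁ ε[Y] ≫ (ρ_ X).hom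

/-- Discard the first factor. -/
def snd (X Y : C) : X ⊗ Y ⟶ Y := ε[X] ▷ Y ≫ (λ_ Y).hom

theorem pair_fst {X Y Z : C} (f : X ⟶ Y) (g : X ⟶ Z) : pair f g ≫ fst Y Z = f := by
  have h : (f ⊗ₘ g) ≫ Y ◁ ε[Z] = X ◁ ε[X] ≫ f ▷ _ := by
    rw [← id_tensorHom, ← id_tensorHom, ← tensorHom_id, tensorHom_comp_tensorHom,
      tensorHom_comp_tensorHom]
    simp
  rw [pair, fst, Category.assoc, reassoc_of% h, comul_counit_assoc]
  simp

theorem pair_snd {X Y Z : C} (f : X ⟶ Y) (g : X ⟶ Z) : pair f g ≫ snd Y Z = g := by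
  have h : (f ⊗ₘ g) ≫ ε[Y] ▷ Z = ε[X] ▷ X ≫ _ ◁ g := by
    rw [← id_tensorHom, ← tensorHom_id, ← tensorHom_id, tensorHom_comp_tensorHom,
      tensorHom_comp_tensorHom]
    simp
  rw [pair, snd, Category.assoc, reassoc_of% h, counit_comul_assoc]
  simp

theorem pair_comp_tensorHom {X Y Z Y' Z' : C} (f : X ⟶ Y) (g : X ⟶ Z) (h : Y ⟶ Y') (k : Z ⟶ Z') :
    pair f g ≫ (h ⊗ₘ k) = pair (f ≫ h) (g ≫ k) := by
  rw [pair, pair, Category.assoc, tensorHom_comp_tensorHom]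

theorem pair_comp_braiding {X Y Z : C} (f : X ⟶ Y) (g : X ⟶ Z) :
    pair f g ≫ (β_ Y Z).hom = pair g f := by
  rw [pair, pair, Category.assoc, BraidedCategory.braiding_naturality,
    IsCommComonObj.comul_comm_assoc]

theorem pair_assoc {X Y Z W : C} (f : X ⟶ Y) (g : X ⟶ Z) (h : X ⟶ W) :
    pair (pair f g) h ≫ (α_ Y Z W).hom = pair f (pair g h) := by
  have e₁ : (Δ[X] ≫ (f ⊗ₘ g)) ⊗ₘ h = Δ[X] ▷ X ≫ ((f ⊗ₘ g) ⊗ₘ h) := by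
    rw [← tensorHom_id, tensorHom_comp_tensorHom, Category.id_comp]
  have e₂ : f ⊗ₘ (Δ[X] ≫ (g ⊗ₘ h)) = X ◁ Δ[X] ≫ (f ⊗ₘ (g ⊗ₘ h)) := by
    rw [← id_tensorHom, tensorHom_comp_tensorHom, Category.id_comp]
  simp only [pair, e₁, e₂, Category.assoc, associator_naturality, comul_assoc_assoc]

/-! ### Copyable morphisms -/

/-- A morphism is copyable if it commutes with duplication. -/
def Copyable {X Y : C} (f : X ⟶ Y) : Prop := f ≫ Δ[Y] = Δ[X] ≫ (f ⊗ₘ f)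

/-- In a Markov category precomposition does not distribute over pairing in general, since running
`k` once differs from running it twice. Copyability is exactly what allows it, and it is available
for multipliers but not for mechanisms. -/
theorem Copyable.comp_pair {W X Y Z : C} {k : W ⟶ X} (hk : Copyable k) (f : X ⟶ Y) (g : X ⟶ Z) :
    k ≫ pair f g = pair (k ≫ f) (k ≫ g) := by
  rw [pair, pair, ← Category.assoc, hk, Category.assoc, tensorHom_comp_tensorHom]

/-- `tensorμ` exchanges the two middle ones of four copies. By coassociativity these two can be
taken to come from a single duplicate, and cocommutativity then absorbs the exchange. This makes
duplication itself copyable. -/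
theorem copy_copy_tensorμ (X : C) :
    Δ[X] ≫ (Δ[X] ⊗ₘ Δ[X]) ≫ tensorμ X X X X = Δ[X] ≫ (Δ[X] ⊗ₘ Δ[X]) := by
  have h : Δ[X] ≫ (Δ[X] ⊗ₘ Δ[X]) = Δ[X] ≫ X ◁ Δ[X] ≫ X ◁ (Δ[X] ▷ X) ≫ X ◁ (α_ X X X).hom ≫
      (α_ X X (X ⊗ X)).inv := by
    rw [← whiskerLeft_comp_assoc, ← whiskerLeft_comp_assoc, Category.assoc, ← comul_assoc,
      MonoidalCategory.tensorHom_def, ← cancel_mono (α_ X X (X ⊗ X)).hom]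
    simp only [Category.assoc, Iso.inv_hom_id, Category.comp_id, MonoidalCategory.whiskerLeft_comp,
      tensor_whiskerLeft, comul_assoc_assoc]
  rw [← Category.assoc, h]
  simp only [tensorμ, Category.assoc, Iso.inv_hom_id_assoc, whiskerLeft_hom_inv_assoc]
  rw [← whiskerLeft_comp_assoc X (Δ[X] ▷ X), ← comp_whiskerRight, IsCommComonObj.comul_comm]

theorem Copyable.comp {X Y Z : C} {f : X ⟶ Y} {g : Y ⟶ Z} (hf : Copyable f) (hg : Copyable g) :
    Copyable (f ≫ g) := by
  rw [Copyable, Category.assoc, hg, reassoc_of% hf, tensorHom_comp_tensorHom]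

theorem Copyable.tensorHom {X Y X' Y' : C} {f : X ⟶ Y} {g : X' ⟶ Y'} (hf : Copyable f)
    (hg : Copyable g) : Copyable (f ⊗ₘ g) := by
  rw [Copyable, copy_tensor, copy_tensor, tensorHom_comp_tensorHom_assoc, hf, hg, Category.assoc,
    ← tensorμ_natural, tensorHom_comp_tensorHom_assoc]

theorem copyable_id (X : C) : Copyable (𝟙 X) := by simp [Copyable]

theorem copyable_copy (X : C) : Copyable Δ[X] := by
  rw [Copyable, copy_tensor, copy_copy_tensorμ]

theorem Copyable.pair {X Y Z : C} {f : X ⟶ Y} {g : X ⟶ Z} (hf : Copyable f) (hg : Copyable g) :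
    Copyable (pair f g) :=
  (copyable_copy X).comp (hf.tensorHom hg)

theorem copyable_discard (X : C) : Copyable ε[X] := by
  rw [Copyable, ← cancel_mono (λ_ (𝟙_ C)).hom]
  exact Subsingleton.elim _ _

theorem copyable_leftUnitor (X : C) : Copyable (λ_ X).hom := by
  rw [Copyable, copy_tensor, copy_unit, MonoidalCategory.tensorHom_def', Category.assoc,
    Category.assoc, ← tensor_left_unitality, leftUnitor_naturality]

theorem copyable_rightUnitor (X : C) : Copyable (ρ_ X).hom := by
  rw [Copyable, copy_tensor, copy_unit, MonoidalCategory.tensorHom_def, Category.assoc,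
    Category.assoc, ← tensor_right_unitality, rightUnitor_naturality]

theorem copyable_fst (X Y : C) : Copyable (fst X Y) := by
  rw [fst, ← id_tensorHom]
  exact ((copyable_id X).tensorHom (copyable_discard Y)).comp (copyable_rightUnitor X)

theorem copyable_snd (X Y : C) : Copyable (snd X Y) := by
  rw [snd, ← tensorHom_id]
  exact ((copyable_discard X).tensorHom (copyable_id Y)).comp (copyable_leftUnitor Y)

/-- Duplicating `X ⊗ Y` and discarding the second copy of `X` is the same as duplicating `Y` alone,
by counitality on `X`. -/
theorem pair_id_snd (X Y : C) :
    pair (𝟙 (X ⊗ Y)) (snd X Y) = X ◁ Δ[Y] ≫ (α_ X Y Y).inv := by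
  have h₁ : 𝟙 (X ⊗ Y) ⊗ₘ snd X Y =
      ((𝟙 X ⊗ₘ 𝟙 Y) ⊗ₘ (ε[X] ⊗ₘ 𝟙 Y)) ≫ (X ⊗ Y) ◁ (λ_ Y).hom := by
    rw [snd, id_tensorHom_id, ← id_tensorHom, tensorHom_comp_tensorHom, tensorHom_id,
      Category.comp_id]
  have h₂ : Δ[X] ≫ (𝟙 X ⊗ₘ ε[X]) = (ρ_ X).inv := by simp
  rw [pair, copy_tensor, h₁, Category.assoc, ← tensorμ_natural_assoc,
    tensorHom_comp_tensorHom_assoc, h₂, id_tensorHom_id, Category.comp_id, tensorμ]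
  simp only [MonoidalCategory.tensorHom_def, braiding_tensorUnit_left]
  have h₃ : X ◁ (ρ_ Y).inv ▷ Y ≫ X ◁ (α_ Y (𝟙_ C) Y).hom ≫ X ◁ Y ◁ (λ_ Y).hom = 𝟙 _ := by
    simp only [← MonoidalCategory.whiskerLeft_comp, triangle, inv_hom_whiskerRight,
      MonoidalCategory.whiskerLeft_id]
  simp [reassoc_of% h₃]

/-- Counitality on `Y`, after `pair_id_snd`. A general morphism into `X ⊗ Y` is not the pair of its
marginals, but the identity is. -/
theorem pair_fst_snd (X Y : C) : pair (fst X Y) (snd X Y) = 𝟙 (X ⊗ Y) := by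
  have h := pair_comp_tensorHom (𝟙 (X ⊗ Y)) (snd X Y) (fst X Y) (𝟙 Y)
  rw [Category.id_comp, Category.comp_id] at h
  rw [← h, pair_id_snd, fst]
  simp only [tensorHom_id, comp_whiskerRight, whisker_assoc, Category.assoc, Iso.inv_hom_id_assoc,
    triangle_assoc_comp_right]
  rw [← MonoidalCategory.whiskerLeft_comp, ← MonoidalCategory.whiskerLeft_comp,
    counit_comul_assoc, Iso.inv_hom_id, MonoidalCategory.whiskerLeft_id]

/-- The outcome of `k` is used by `f` only, so `k` can be moved into that component without being
duplicated. Hence no copyability of `k` is required, and `k` may involve a mechanism. -/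
theorem pair_comp_pair_snd {X Y Z W : C} (k : X ⟶ Y) (f : Y ⊗ X ⟶ Z) (g : X ⟶ W) :
    pair k (𝟙 X) ≫ pair f (snd Y X ≫ g) = pair (pair k (𝟙 X) ≫ f) g := by
  have h : pair f (snd Y X ≫ g) = pair (𝟙 _) (snd Y X) ≫ (f ⊗ₘ g) := by
    rw [pair_comp_tensorHom, Category.id_comp]
  have h' : pair k (𝟙 X) ≫ pair (𝟙 _) (snd Y X) = pair (pair k (𝟙 X)) (𝟙 X) := by
    rw [pair_id_snd, ← cancel_mono (α_ Y X X).hom, pair_assoc, Category.assoc, Category.assoc,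
      Iso.inv_hom_id, Category.comp_id, ← id_tensorHom, pair_comp_tensorHom]
    simp [pair]
  rw [h, reassoc_of% h', pair_comp_tensorHom, Category.id_comp]

theorem pair_comp_snd_pair {X Y Z W : C} (k : X ⟶ Y) (f : Y ⊗ X ⟶ Z) (g : X ⟶ W) :
    pair k (𝟙 X) ≫ pair (snd Y X ≫ g) f = pair g (pair k (𝟙 X) ≫ f) := by
  rw [← pair_comp_braiding f, ← Category.assoc, pair_comp_pair_snd, pair_comp_braiding]

end CategoryTheory.MarkovCategory

/-! ### Calculus of multipliers in `Cau(G)` -/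

namespace CausalGraph

open MarkovCategory

variable {V : Type u} {G : CausalGraph V}

theorem CanRun.mono {v w : List V} (hvw : ∀ x ∈ v, x ∈ w) : ∀ {s l : List V}, G.CanRun w s l →
    G.CanRun v s l
  | _, [], h => fun x hx => h x (hvw x hx)
  | _, _ :: _, h => ⟨h.1, CanRun.mono hvw h.2⟩

/-- Discards are natural, so the components of a pairing are automatically its two marginals. -/
theorem condIndep_of_eq_pair {u v w : List V} {f : G.word u ⟶ G.word v ⊗ G.word w}
    {g : G.word u ⟶ G.word v} {h : G.word u ⟶ G.word w} (e : f = pair g h) : CondIndep f := by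
  have h₁ : f ≫ fst _ _ = g := e ▸ pair_fst g h
  have h₂ : f ≫ snd _ _ = h := e ▸ pair_snd g h
  rw [fst] at h₁
  rw [snd] at h₂
  rw [CondIndep, h₁, h₂, e, pair]

variable (G) [DecidableEq V]

theorem proj_self (x : V) (s : List V) (h : x ∈ x :: s) :
    G.proj (x :: s) x h = fst (G.word [x]) (G.word s) := by
  refine (dif_pos rfl).trans ?_
  rw [id_tensorHom]
  rfl

theorem proj_of_ne {x y : V} (e : x ≠ y) (s : List V) (h : x ∈ y :: s) (h' : x ∈ s) :
    G.proj (y :: s) x h = snd (G.word [y]) (G.word s) ≫ G.proj s x h' := by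
  refine (dif_neg e).trans ?_
  rw [MonoidalCategory.tensorHom_def, snd, Category.assoc, ← leftUnitor_naturality]
  -- The left unitor of `Cau(G)` is a cast along `[] ++ a = a`, hence definitionally an identity.
  exact congrArg _ (Category.comp_id (𝟙_ G.Cau ◁ G.proj s x h')).symm

theorem copyable_proj (s : List V) (x : V) (h : x ∈ s) : Copyable (G.proj s x h) := by
  induction s with
  | nil => simp at h
  | cons y s ih =>
    by_cases e : x = y
    · subst e
      rw [proj_self]
      exact copyable_fst _ _
    · have h' : x ∈ s := by simpa [e] using h
      rw [proj_of_ne G e s h h']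
      exact (copyable_snd _ _).comp (ih h')

theorem multiplier_cons (s : List V) (x : V) (w : List V) (h : ∀ y ∈ x :: w, y ∈ s) :
    G.multiplier s (x :: w) h = pair (G.proj s x (h x (by simp)))
      (G.multiplier s w fun y hy => h y (by simp [hy])) := rfl

theorem copyable_multiplier (s w : List V) (h : ∀ x ∈ w, x ∈ s) :
    Copyable (G.multiplier s w h) := by
  induction w with
  | nil => exact copyable_discard _
  | cons x w ih => exact (G.copyable_proj _ _ _).pair (ih _)

theorem multiplier_append (s a b : List V) (h : ∀ x ∈ a ++ b, x ∈ s) :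
    G.multiplier s (a ++ b) h = pair (G.multiplier s a fun x hx => h x (by simp [hx]))
      (G.multiplier s b fun x hx => h x (by simp [hx])) := by
  induction a with
  | nil =>
    -- For the empty prefix the first component is a discard, and projecting away an empty word is
    -- an identity.
    have e := pair_snd ε[G.word s] (G.multiplier s b fun x hx => h x (by simp [hx]))
    rw [snd, CopyDiscardCategory.discard_unit, id_whiskerRight, Category.id_comp] at e
    exact e.symm.trans (Category.comp_id _)
  | cons x a ih =>
    have h' : ∀ y ∈ a ++ b, y ∈ s := fun y hy => h y (by simp_all)
    refine (congrArg (pair (G.proj s x (h x (by simp)))) (ih h')).trans ?_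
    exact (pair_assoc _ _ _).symm.trans (Category.comp_id _)

theorem multiplier_comp_proj (s s' : List V) (h : ∀ x ∈ s', x ∈ s) (x : V) (hx : x ∈ s') :
    G.multiplier s s' h ≫ G.proj s' x hx = G.proj s x (h x hx) := by
  induction s' with
  | nil => simp at hx
  | cons y s' ih =>
    by_cases e : x = y
    · subst e
      rw [proj_self]
      exact pair_fst _ _
    · have h' : x ∈ s' := by simpa [e] using hx
      rw [proj_of_ne G e s' hx h', ← ih (fun z hz => h z (by simp [hz])) h']
      refine (Category.assoc _ _ _).symm.trans ?_
      exact congrArg (· ≫ G.proj s' x h') (pair_snd _ _)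

/-- The first multiplier is copyable, so it distributes over the pairing that defines the second. -/
theorem multiplier_comp_multiplier (s s' w : List V) (h : ∀ x ∈ s', x ∈ s) (h' : ∀ x ∈ w, x ∈ s') :
    G.multiplier s s' h ≫ G.multiplier s' w h' = G.multiplier s w fun x hx => h x (h' x hx) := by
  induction w with
  | nil => exact discard_natural _
  | cons x w ih =>
    have h'' : ∀ y ∈ w, y ∈ s' := fun y hy => h' y (by simp [hy])
    refine ((G.copyable_multiplier s s' h).comp_pair (G.proj s' x (h' x (by simp)))
      (G.multiplier s' w h'')).trans ?_
    rw [multiplier_comp_proj, ih h'']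
    rfl

theorem multiplier_cons_left (y : V) (s w : List V) (hy : y ∉ w) (h : ∀ x ∈ w, x ∈ s) :
    G.multiplier (y :: s) w (fun x hx => List.mem_cons_of_mem _ (h x hx)) =
      snd (G.word [y]) (G.word s) ≫ G.multiplier s w h := by
  induction w with
  | nil => exact (discard_natural (snd (G.word [y]) (G.word s))).symm
  | cons x w ih =>
    have h' : ∀ y ∈ w, y ∈ s := fun y hy => h y (by simp [hy])
    refine Eq.trans ?_ ((copyable_snd (G.word [y]) (G.word s)).comp_pair
      (G.proj s x (h x (by simp))) (G.multiplier s w h')).symm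
    rw [multiplier_cons, ih (fun hw => hy (by simp [hw])) h',
      proj_of_ne G (fun e => hy (by simp [e])) s _ (h x (by simp))]
    rfl

/-- Without `Nodup` this fails: `proj` always selects the first occurrence of a letter, so later
occurrences would be overwritten. -/
theorem multiplier_self (s : List V) (hs : s.Nodup) :
    G.multiplier s s (fun _ h => h) = 𝟙 (G.word s) := by
  induction s with
  | nil => exact CopyDiscardCategory.discard_unit
  | cons x s ih =>
    rw [List.nodup_cons] at hs
    rw [multiplier_cons, multiplier_cons_left G x s s hs.1 fun _ h => h, ih hs.2, proj_self]
    exact (congrArg _ (Category.comp_id _)).trans (pair_fst_snd _ _)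

theorem addMechanism_eq (s : List V) (x : V) (h : ∀ y ∈ G.pa x, y ∈ s) :
    G.addMechanism s x h = pair (G.multiplier s (G.pa x) h ≫ G.mechanism x) (𝟙 (G.word s)) := rfl

theorem addMechanism_comp_snd (s : List V) (x : V) (h : ∀ y ∈ G.pa x, y ∈ s) :
    G.addMechanism s x h ≫ snd (G.word [x]) (G.word s) = 𝟙 (G.word s) :=
  pair_snd _ _

/-- A mechanism whose outcome is discarded disappears, by naturality of discards. -/
theorem addMechanism_comp_multiplier (s w : List V) (x : V) (h : ∀ y ∈ G.pa x, y ∈ s)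
    (hx : x ∉ w) (hw : ∀ y ∈ w, y ∈ s) :
    G.addMechanism s x h ≫
      G.multiplier (x :: s) w (fun y hy => List.mem_cons_of_mem _ (hw y hy)) =
      G.multiplier s w hw := by
  rw [multiplier_cons_left G x s w hx hw]
  refine (Category.assoc _ _ _).symm.trans ?_
  refine (congrArg (· ≫ G.multiplier s w hw) (G.addMechanism_comp_snd s x h)).trans ?_
  exact Category.id_comp _

/-- Wires that `κ_x` does not need may be dropped before it is run instead of afterwards. -/
theorem addMechanism_comp_multiplier_cons (s s' : List V) (x : V) (h : ∀ y ∈ G.pa x, y ∈ s')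
    (hx : x ∉ s') (hs : ∀ y ∈ s', y ∈ s) (hs' : ∀ y ∈ x :: s', y ∈ x :: s) :
    G.addMechanism s x (fun y hy => hs y (h y hy)) ≫ G.multiplier (x :: s) (x :: s') hs' =
      G.multiplier s s' hs ≫ G.addMechanism s' x h := by
  have e : G.multiplier (x :: s) (x :: s') hs' =
      𝟙 (G.word [x]) ⊗ₘ G.multiplier s s' hs := by
    rw [multiplier_cons, multiplier_cons_left G x s s' hx hs, proj_self]
    have := pair_comp_tensorHom (fst (G.word [x]) (G.word s)) (snd (G.word [x]) (G.word s))
      (𝟙 _) (G.multiplier s s' hs)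
    rw [pair_fst_snd, Category.id_comp, Category.comp_id] at this
    exact this.symm
  rw [e]
  refine (pair_comp_tensorHom _ _ _ _).trans (Eq.trans ?_
    ((G.copyable_multiplier s s' hs).comp_pair
      (G.multiplier s' (G.pa x) h ≫ G.mechanism x) (𝟙 _)).symm)
  rw [← Category.assoc, multiplier_comp_multiplier, Category.comp_id, Category.comp_id,
    Category.id_comp]

/-! ### Runs and sets closed under parents -/

variable {G}

/-- If `A` contains the targets and is closed under parents at each mechanism of `l`, nothing
outside `A` influences the result. A mechanism in `A` can be run on the reduced wires `s'`, and one
outside `A` is erased. -/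
theorem run_factors {v : List V} {A : Set V} (hv : ∀ x ∈ v, x ∈ A) : ∀ {s l : List V}
    (s' : List V) (h : G.CanRun v s l) (hs : ∀ x ∈ s', x ∈ s), l.Nodup → (∀ x ∈ l, x ∉ s) →
    (∀ x ∈ l, x ∈ A → ∀ y ∈ G.pa x, y ∈ A) → (∀ x ∈ s, x ∈ A → x ∈ s') →
    ∃ g : G.word s' ⟶ G.word v, G.run v s l h = G.multiplier s s' hs ≫ g
  | s, [], s', h, hs, _, _, _, hA => by
    have h' : ∀ x ∈ v, x ∈ s' := fun x hx => hA x (h x hx) (hv x hx)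
    exact ⟨G.multiplier s' v h', (G.multiplier_comp_multiplier s s' v hs h').symm⟩
  | s, x :: l, s', h, hs, hn, hd, hcl, hA => by
    rw [List.nodup_cons] at hn
    have hxs : x ∉ s := hd x (by simp)
    have hd' : ∀ y ∈ l, y ∉ x :: s := fun y hy hy' => by
      rcases List.mem_cons.1 hy' with rfl | hy'
      · exact hn.1 hy
      · exact hd y (by simp [hy]) hy'
    have hcl' : ∀ y ∈ l, y ∈ A → ∀ z ∈ G.pa y, z ∈ A := fun y hy => hcl y (by simp [hy])
    have hxs' : x ∉ s' := fun hx => hxs (hs x hx)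
    by_cases hx : x ∈ A
    · have hp : ∀ y ∈ G.pa x, y ∈ s' := fun y hy => hA y (h.1 y hy) (hcl x (by simp) hx y hy)
      obtain ⟨g, hg⟩ := run_factors hv (x :: s') h.2 (by simpa using fun y hy => .inr (hs y hy))
        hn.2 hd' hcl' (by simpa using fun y hy hyA => .inr (hA y hy hyA))
      refine ⟨G.addMechanism s' x hp ≫ g, ?_⟩
      rw [run, hg, ← Category.assoc, ← Category.assoc,
        addMechanism_comp_multiplier_cons G s s' x hp hxs' hs]
    · obtain ⟨g, hg⟩ := run_factors hv s' h.2 (fun y hy => List.mem_cons_of_mem _ (hs y hy))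
        hn.2 hd' hcl' (by
          intro y hy hyA
          rcases List.mem_cons.1 hy with rfl | hy
          · exact absurd hyA hx
          · exact hA y hy hyA)
      exact ⟨g, by rw [run, hg, ← Category.assoc, addMechanism_comp_multiplier G s s' x h.1 hxs' hs]⟩

/-- A mechanism whose outcome is irrelevant for `v` drops out of a run. -/
theorem run_cons_of_notMem {v : List V} {A : Set V} (hv : ∀ x ∈ v, x ∈ A) {s l : List V} {x : V}
    (h : G.CanRun v (x :: s) l) (hs : s.Nodup) (hxs : x ∉ s) (hn : l.Nodup)
    (hd : ∀ y ∈ l, y ∉ x :: s) (hcl : ∀ x ∈ l, x ∈ A → ∀ y ∈ G.pa x, y ∈ A) (hx : x ∉ A) :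
    ∃ g : G.word s ⟶ G.word v, G.run v (x :: s) l h = snd (G.word [x]) (G.word s) ≫ g := by
  obtain ⟨g, hg⟩ := run_factors hv s h (fun y hy => List.mem_cons_of_mem _ hy) hn hd hcl (by
    intro y hy hyA
    rcases List.mem_cons.1 hy with rfl | hy
    · exact absurd hyA hx
    · exact hy)
  refine ⟨g, ?_⟩
  rw [hg, multiplier_cons_left G x s s hxs fun _ h => h, multiplier_self G s hs]
  exact congrArg (· ≫ g) (Category.comp_id _)

/-- The core of the "if" direction. The sets `A` and `B` contain everything that matters for `v` and
for `w`; as no mechanism lies in both, none has to be duplicated when the run is split in two. -/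
theorem run_append_eq_pair {v w : List V} {A B : Set V} (hv : ∀ x ∈ v, x ∈ A)
    (hw : ∀ x ∈ w, x ∈ B) : ∀ {s l : List V} (h : G.CanRun (v ++ w) s l), s.Nodup → l.Nodup →
    (∀ x ∈ l, x ∉ s) → (∀ x ∈ l, x ∈ A → ∀ y ∈ G.pa x, y ∈ A) →
    (∀ x ∈ l, x ∈ B → ∀ y ∈ G.pa x, y ∈ B) → (∀ x ∈ l, x ∈ A → x ∉ B) →
    G.run (v ++ w) s l h = pair (G.run v s l (h.mono (by simp +contextual)))
      (G.run w s l (h.mono (by simp +contextual)))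
  | s, [], h, _, _, _, _, _, _ => G.multiplier_append s v w h
  | s, x :: l, h, hs, hn, hd, hA, hB, hAB => by
    rw [List.nodup_cons] at hn
    have hxs : x ∉ s := hd x (by simp)
    have hd' : ∀ y ∈ l, y ∉ x :: s := fun y hy hy' => by
      rcases List.mem_cons.1 hy' with rfl | hy'
      · exact hn.1 hy
      · exact hd y (by simp [hy]) hy'
    have hA' : ∀ y ∈ l, y ∈ A → ∀ z ∈ G.pa y, z ∈ A := fun y hy => hA y (by simp [hy])
    have hB' : ∀ y ∈ l, y ∈ B → ∀ z ∈ G.pa y, z ∈ B := fun y hy => hB y (by simp [hy])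
    have ih := run_append_eq_pair hv hw h.2 (List.nodup_cons.2 ⟨hxs, hs⟩) hn.2 hd' hA' hB'
      fun y hy => hAB y (by simp [hy])
    rw [run, ih, run, run]
    -- In either case one of the two runs ignores the new wire. The mechanism goes into the other
    -- component and is restored formally on the ignoring side by `addMechanism_comp_snd`.
    by_cases hx : x ∈ A
    · obtain ⟨g, hg⟩ := run_cons_of_notMem hw (h.2.mono (by simp +contextual)) hs hxs hn.2 hd' hB'
        (hAB x (by simp) hx)
      rw [hg]
      refine (pair_comp_pair_snd _ _ _).trans (congrArg (pair _) ?_)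
      refine Eq.trans ?_ (Category.assoc _ _ _)
      exact (Category.id_comp _).symm.trans
        (congrArg (· ≫ g) (G.addMechanism_comp_snd s x h.1).symm)
    · obtain ⟨g, hg⟩ := run_cons_of_notMem hv (h.2.mono (by simp +contextual)) hs hxs hn.2 hd' hA'
        hx
      rw [hg]
      refine (pair_comp_snd_pair _ _ _).trans (congrArg (pair · _) ?_)
      refine Eq.trans ?_ (Category.assoc _ _ _)
      exact (Category.id_comp _).symm.trans
        (congrArg (· ≫ g) (G.addMechanism_comp_snd s x h.1).symm)

end CausalGraph

/-! ### Models of `Cau(G)` in total relations -/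

namespace CausalGraph

open MarkovCategory

variable {V : Type u} {G : CausalGraph V} {α : Type*}

/-- A choice, for every vertex, of a total relation from lists of values of its parents to values
of the vertex. -/
structure Model (V : Type*) (α : Type*) where
  rel : V → List α → α → Prop
  total : ∀ x p, ∃ b, rel x p b

namespace Term

/-- The relation between input values and output values denoted by a formal morphism. -/
def sem (M : Model V α) : ∀ {a b : List V}, G.Term a b → List α → List α → Prop
  | _, _, .id a => fun p q => p.length = a.length ∧ q = p
  | _, _, .comp f g => fun p q => ∃ r, f.sem M p r ∧ g.sem M r q
  | _, _, .tensor f g => fun p q => ∃ p₁ p₂ q₁ q₂, p = p₁ ++ p₂ ∧ q = q₁ ++ q₂ ∧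
      f.sem M p₁ q₁ ∧ g.sem M p₂ q₂
  | _, _, .swap a b => fun p q => ∃ p₁ p₂, p₁.length = a.length ∧ p₂.length = b.length ∧
      p = p₁ ++ p₂ ∧ q = p₂ ++ p₁
  | _, _, .copy a => fun p q => p.length = a.length ∧ q = p ++ p
  | _, _, .discard a => fun p q => p.length = a.length ∧ q = []
  | _, _, .mech x => fun p q => p.length = (G.pa x).length ∧ ∃ b, M.rel x p b ∧ q = [b]

variable {M : Model V α}

theorem sem_length {a b : List V} (f : G.Term a b) : ∀ {p q : List α}, f.sem M p q →
    p.length = a.length ∧ q.length = b.length := by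
  induction f with
  | id a => rintro p q ⟨h, rfl⟩; exact ⟨h, h⟩
  | comp f g hf hg => rintro p q ⟨r, h, h'⟩; exact ⟨(hf h).1, (hg h').2⟩
  | tensor f g hf hg =>
    rintro p q ⟨p₁, p₂, q₁, q₂, rfl, rfl, h, h'⟩
    simp [hf h, hg h']
  | swap a b => rintro p q ⟨p₁, p₂, h₁, h₂, rfl, rfl⟩; simp [h₁, h₂]
  | copy a => rintro p q ⟨h, rfl⟩; simp [h]
  | discard a => rintro p q ⟨h, rfl⟩; simp [h]
  | mech x => rintro p q ⟨h, b, -, rfl⟩; simp [h]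

theorem exists_split {β : Type*} {p : List α} {a b : List β} (h : p.length = (a ++ b).length) :
    ∃ p₁ p₂, p = p₁ ++ p₂ ∧ p₁.length = a.length ∧ p₂.length = b.length :=
  ⟨p.take a.length, p.drop a.length, (List.take_append_drop _ _).symm, by simp_all, by simp_all⟩

/-- Totality is what validates naturality of discards: a partial relation would remember, after the
discard, whether an output exists. -/
theorem sem_total {a b : List V} (f : G.Term a b) : ∀ {p : List α}, p.length = a.length →
    ∃ q, f.sem M p q := by
  induction f with
  | id a => exact fun h => ⟨_, h, rfl⟩
  | comp f g hf hg =>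
    intro p h
    obtain ⟨r, hr⟩ := hf h
    obtain ⟨q, hq⟩ := hg (sem_length _ hr).2
    exact ⟨q, r, hr, hq⟩
  | tensor f g hf hg =>
    intro p h
    obtain ⟨p₁, p₂, rfl, h₁, h₂⟩ := exists_split h
    obtain ⟨q₁, h₁⟩ := hf h₁
    obtain ⟨q₂, h₂⟩ := hg h₂
    exact ⟨q₁ ++ q₂, p₁, p₂, q₁, q₂, rfl, rfl, h₁, h₂⟩
  | swap a b =>
    intro p h
    obtain ⟨p₁, p₂, rfl, h₁, h₂⟩ := exists_split h
    exact ⟨p₂ ++ p₁, p₁, p₂, h₁, h₂, rfl, rfl⟩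
  | copy a => exact fun h => ⟨_, h, rfl⟩
  | discard a => exact fun h => ⟨_, h, rfl⟩
  | mech x =>
    intro p h
    obtain ⟨b, hb⟩ := M.total x p
    exact ⟨[b], h, b, hb, rfl⟩

theorem sem_cast {a b : List V} (h : a = b) (p q : List α) :
    (cast h : G.Term a b).sem M p q ↔ p.length = a.length ∧ q = p := by
  subst h; rfl

/-- Soundness of the model. Values are untyped lists, so related terms with different indices can be
compared directly; `sem_length` recovers where a list has to be cut. -/
theorem Rel.sem_iff {a b a' b' : List V} {f : G.Term a b} {g : G.Term a' b'} (h : Rel f g) :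
    ∀ p q : List α, f.sem M p q ↔ g.sem M p q := by
  induction h with
  | refl f => exact fun _ _ => Iff.rfl
  | symm _ ih => exact fun p q => (ih p q).symm
  | trans _ _ ih ih' => exact fun p q => (ih p q).trans (ih' p q)
  | comp_congr _ _ ih ih' => intro p q; simp only [sem, ih, ih']
  | tensor_congr _ _ ih ih' => intro p q; simp only [sem, ih, ih']
  | id_comp f =>
    exact fun p q => ⟨by rintro ⟨r, ⟨_, rfl⟩, h⟩; exact h, fun h => ⟨p, ⟨(sem_length _ h).1, rfl⟩, h⟩⟩
  | comp_id f =>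
    exact fun p q => ⟨by rintro ⟨r, h, _, rfl⟩; exact h, fun h => ⟨q, h, (sem_length _ h).2, rfl⟩⟩
  | assoc f g h =>
    intro p q
    constructor
    · rintro ⟨r, ⟨r', h₁, h₂⟩, h₃⟩
      exact ⟨r', h₁, r, h₂, h₃⟩
    · rintro ⟨r, h₁, r', h₂, h₃⟩
      exact ⟨r', ⟨r, h₁, h₂⟩, h₃⟩
  | tensor_id a b =>
    intro p q
    constructor
    · rintro ⟨p₁, p₂, q₁, q₂, rfl, rfl, ⟨h₁, rfl⟩, h₂, rfl⟩
      exact ⟨by simp [h₁, h₂], rfl⟩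
    · rintro ⟨h, rfl⟩
      obtain ⟨p₁, p₂, rfl, h₁, h₂⟩ := exists_split h
      exact ⟨p₁, p₂, p₁, p₂, rfl, rfl, ⟨h₁, rfl⟩, h₂, rfl⟩
  | tensor_comp f g f' g' =>
    intro p q
    constructor
    · rintro ⟨p₁, p₂, q₁, q₂, rfl, rfl, ⟨r₁, h₁, h₁'⟩, r₂, h₂, h₂'⟩
      exact ⟨r₁ ++ r₂, ⟨p₁, p₂, r₁, r₂, rfl, rfl, h₁, h₂⟩, r₁, r₂, q₁, q₂, rfl, rfl, h₁', h₂'⟩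
    · rintro ⟨_, ⟨p₁, p₂, r₁, r₂, rfl, rfl, h₁, h₂⟩, r₁', r₂', q₁, q₂, e, rfl, h₁', h₂'⟩
      obtain ⟨rfl, rfl⟩ := List.append_inj e
        ((sem_length _ h₁).2.trans (sem_length _ h₁').1.symm)
      exact ⟨p₁, p₂, q₁, q₂, rfl, rfl, ⟨r₁, h₁, h₁'⟩, r₂, h₂, h₂'⟩
  | tensor_assoc f g h =>
    intro p q
    constructor
    · rintro ⟨_, p₃, _, q₃, rfl, rfl, ⟨p₁, p₂, q₁, q₂, rfl, rfl, h₁, h₂⟩, h₃⟩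
      exact ⟨p₁, p₂ ++ p₃, q₁, q₂ ++ q₃, by simp, by simp, h₁, p₂, p₃, q₂, q₃, rfl, rfl, h₂, h₃⟩
    · rintro ⟨p₁, _, q₁, _, rfl, rfl, h₁, p₂, p₃, q₂, q₃, rfl, rfl, h₂, h₃⟩
      exact ⟨p₁ ++ p₂, p₃, q₁ ++ q₂, q₃, by simp, by simp, ⟨p₁, p₂, q₁, q₂, rfl, rfl, h₁, h₂⟩, h₃⟩
  | unit_tensor f =>
    intro p q
    constructor
    · rintro ⟨p₁, p₂, q₁, q₂, rfl, rfl, ⟨h₁, rfl⟩, h₂⟩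
      obtain rfl := List.length_eq_zero_iff.1 h₁
      exact h₂
    · exact fun h => ⟨[], p, [], q, rfl, rfl, ⟨rfl, rfl⟩, h⟩
  | tensor_unit f =>
    intro p q
    constructor
    · rintro ⟨p₁, p₂, q₁, q₂, rfl, rfl, h₂, ⟨h₁, rfl⟩⟩
      obtain rfl := List.length_eq_zero_iff.1 h₁
      simpa using h₂
    · exact fun h => ⟨p, [], q, [], by simp, by simp, h, rfl, rfl⟩
  | swap_natural f g =>
    intro p q
    constructor
    · rintro ⟨_, ⟨p₁, p₂, r₁, r₂, rfl, rfl, h₁, h₂⟩, r₁', r₂', e₁, e₂, e, rfl⟩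
      obtain ⟨rfl, rfl⟩ := List.append_inj e ((sem_length _ h₁).2.trans e₁.symm)
      exact ⟨p₂ ++ p₁, ⟨p₁, p₂, (sem_length _ h₁).1, (sem_length _ h₂).1, rfl, rfl⟩, p₂, p₁, r₂, r₁,
        rfl, rfl, h₂, h₁⟩
    · rintro ⟨_, ⟨p₁, p₂, e₁, e₂, rfl, rfl⟩, p₂', p₁', q₂, q₁, e, rfl, h₂, h₁⟩
      obtain ⟨rfl, rfl⟩ := List.append_inj e (e₂.trans (sem_length _ h₂).1.symm)
      exact ⟨q₁ ++ q₂, ⟨p₁, p₂, q₁, q₂, rfl, rfl, h₁, h₂⟩, q₁, q₂, (sem_length _ h₁).2,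
        (sem_length _ h₂).2, rfl, rfl⟩
  | swap_swap a b =>
    intro p q
    constructor
    · rintro ⟨_, ⟨p₁, p₂, e₁, e₂, rfl, rfl⟩, p₂', p₁', e₂', e₁', e, rfl⟩
      obtain ⟨rfl, rfl⟩ := List.append_inj e (e₂.trans e₂'.symm)
      exact ⟨by simp [e₁, e₂], rfl⟩
    · rintro ⟨h, rfl⟩
      obtain ⟨p₁, p₂, rfl, h₁, h₂⟩ := exists_split h
      exact ⟨p₂ ++ p₁, ⟨p₁, p₂, h₁, h₂, rfl, rfl⟩, p₂, p₁, h₂, h₁, rfl, rfl⟩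
  | swap_append a b c =>
    intro p q
    constructor
    · rintro ⟨p₁, r, h₁, hr, rfl, rfl⟩
      obtain ⟨p₂, p₃, rfl, h₂, h₃⟩ := exists_split hr
      refine ⟨(p₂ ++ p₁) ++ p₃, ⟨p₁ ++ p₂, p₃, p₂ ++ p₁, p₃, by simp, rfl,
        ⟨p₁, p₂, h₁, h₂, rfl, rfl⟩, h₃, rfl⟩, (p₂ ++ p₁) ++ p₃, ?_, ?_⟩
      · rw [sem_cast]
        exact ⟨by simp [h₁, h₂, h₃], rfl⟩
      · exact ⟨p₂, p₁ ++ p₃, p₂, p₃ ++ p₁, by simp, by simp, ⟨h₂, rfl⟩, p₁, p₃, h₁, h₃, rfl, rfl⟩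
    · rintro ⟨_, ⟨_, _, _, p₃, rfl, rfl, ⟨p₁, p₂, h₁, h₂, rfl, rfl⟩, h₃, rfl⟩, r, hr, hq⟩
      rw [sem_cast] at hr
      obtain ⟨-, rfl⟩ := hr
      obtain ⟨p₂', _, _, _, e, rfl, ⟨h₂', rfl⟩, p₁', p₃', h₁', h₃', rfl, rfl⟩ := hq
      rw [List.append_assoc] at e
      obtain ⟨rfl, e'⟩ := List.append_inj e (h₂.trans h₂'.symm)
      obtain ⟨rfl, rfl⟩ := List.append_inj e' (h₁.trans h₁'.symm)
      exact ⟨p₁, p₂ ++ p₃, h₁, by simp [h₂, h₃], by simp, by simp⟩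
  | copy_assoc a =>
    intro p q
    constructor
    · rintro ⟨_, ⟨h, rfl⟩, p₁, p₂, _, _, e, rfl, ⟨h₁, rfl⟩, h₂, rfl⟩
      obtain ⟨rfl, rfl⟩ := List.append_inj e (h.trans h₁.symm)
      exact ⟨p ++ p, ⟨h, rfl⟩, p, p, p, p ++ p, rfl, by simp, ⟨h, rfl⟩, h, rfl⟩
    · rintro ⟨_, ⟨h, rfl⟩, p₁, p₂, _, _, e, rfl, ⟨h₁, rfl⟩, h₂, rfl⟩
      obtain ⟨rfl, rfl⟩ := List.append_inj e (h.trans h₁.symm)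
      exact ⟨p ++ p, ⟨h, rfl⟩, p, p, p ++ p, p, rfl, by simp, ⟨h, rfl⟩, h, rfl⟩
  | copy_discard_right a =>
    intro p q
    constructor
    · rintro ⟨_, ⟨h, rfl⟩, p₁, p₂, _, _, e, rfl, ⟨h₁, rfl⟩, h₂, rfl⟩
      obtain ⟨rfl, rfl⟩ := List.append_inj e (h.trans h₁.symm)
      exact ⟨h, by simp⟩
    · rintro ⟨h, rfl⟩
      exact ⟨q ++ q, ⟨h, rfl⟩, q, q, q, [], rfl, by simp, ⟨h, rfl⟩, h, rfl⟩
  | copy_discard_left a =>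
    intro p q
    constructor
    · rintro ⟨_, ⟨h, rfl⟩, p₁, p₂, _, _, e, rfl, ⟨h₁, rfl⟩, h₂, rfl⟩
      obtain ⟨rfl, rfl⟩ := List.append_inj e (h.trans h₁.symm)
      exact ⟨h, by simp⟩
    · rintro ⟨h, rfl⟩
      exact ⟨q ++ q, ⟨h, rfl⟩, q, q, [], q, rfl, by simp, ⟨h, rfl⟩, h, rfl⟩
  | copy_swap a =>
    intro p q
    constructor
    · rintro ⟨_, ⟨h, rfl⟩, p₁, p₂, h₁, h₂, e, rfl⟩
      obtain ⟨rfl, rfl⟩ := List.append_inj e (h.trans h₁.symm)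
      exact ⟨h, rfl⟩
    · rintro ⟨h, rfl⟩
      exact ⟨p ++ p, ⟨h, rfl⟩, p, p, h, h, rfl, rfl⟩
  | copy_append a b =>
    intro p q
    constructor
    · rintro ⟨h, rfl⟩
      obtain ⟨p₁, p₂, rfl, h₁, h₂⟩ := exists_split h
      refine ⟨(p₁ ++ p₁) ++ (p₂ ++ p₂), ⟨p₁, p₂, p₁ ++ p₁, p₂ ++ p₂, rfl, rfl, ⟨h₁, rfl⟩, h₂, rfl⟩,
        (p₁ ++ p₁) ++ (p₂ ++ p₂), ?_, ?_⟩
      · rw [sem_cast]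
        exact ⟨by simp [h₁, h₂], rfl⟩
      · exact ⟨p₁ ++ (p₁ ++ p₂), p₂, p₁ ++ (p₂ ++ p₁), p₂, by simp, by simp,
          ⟨p₁, p₁ ++ p₂, p₁, p₂ ++ p₁, rfl, rfl, ⟨h₁, rfl⟩, p₁, p₂, h₁, h₂, rfl, rfl⟩, h₂, rfl⟩
    · rintro ⟨_, ⟨p₁, p₂, _, _, rfl, rfl, ⟨h₁, rfl⟩, h₂, rfl⟩, r, hr, hq⟩
      rw [sem_cast] at hr
      obtain ⟨-, rfl⟩ := hr
      obtain ⟨_, p₂', _, _, e, rfl, ⟨p₁', _, _, _, rfl, rfl, ⟨h₁', rfl⟩, p₁'', p₂'', h₁'', h₂'', rfl,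
        rfl⟩, h₂', rfl⟩ := hq
      simp only [List.append_assoc] at e
      obtain ⟨rfl, e'⟩ := List.append_inj e (h₁.trans h₁'.symm)
      obtain ⟨rfl, e''⟩ := List.append_inj e' (h₁.trans h₁''.symm)
      obtain ⟨rfl, rfl⟩ := List.append_inj e'' (h₂.trans h₂''.symm)
      exact ⟨by simp [h₁, h₂], by simp⟩
  | discard_append a b =>
    intro p q
    constructor
    · rintro ⟨h, rfl⟩
      obtain ⟨p₁, p₂, rfl, h₁, h₂⟩ := exists_split h
      exact ⟨p₁, p₂, [], [], rfl, rfl, ⟨h₁, rfl⟩, h₂, rfl⟩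
    · rintro ⟨p₁, p₂, _, _, rfl, rfl, ⟨h₁, rfl⟩, h₂, rfl⟩
      exact ⟨by simp [h₁, h₂], rfl⟩
  | discard_natural f =>
    intro p q
    constructor
    · rintro ⟨r, h, -, rfl⟩
      exact ⟨(sem_length _ h).1, rfl⟩
    · rintro ⟨h, rfl⟩
      obtain ⟨r, hr⟩ := sem_total (M := M) f h
      exact ⟨r, hr, (sem_length _ hr).2, rfl⟩

end Term

/-! ### Semantics of multipliers, mechanisms and runs -/

/-- The relation between input values and output values denoted by a morphism of `Cau(G)`. -/
def sem (M : Model V α) {a b : G.Cau} (f : a ⟶ b) : List α → List α → Prop :=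
  Quotient.lift (s := Term.setoid G a b) (Term.sem M)
    (fun _ _ h => funext₂ fun p q => propext (h.sem_iff p q)) f

variable {M : Model V α}

theorem sem_id {a : List V} {p q : List α} :
    sem M (𝟙 (G.word a)) p q ↔ p.length = a.length ∧ q = p := Iff.rfl

theorem sem_comp {a b c : G.Cau} (f : a ⟶ b) (g : b ⟶ c) {p q : List α} :
    sem M (f ≫ g) p q ↔ ∃ r, sem M f p r ∧ sem M g r q := by
  obtain ⟨f⟩ := f
  obtain ⟨g⟩ := g
  rfl

theorem sem_discard {a : List V} {p q : List α} :
    sem M ε[G.word a] p q ↔ p.length = a.length ∧ q = [] := Iff.rfl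

theorem sem_mechanism {x : V} {p q : List α} :
    sem M (G.mechanism x) p q ↔ p.length = (G.pa x).length ∧ ∃ b, M.rel x p b ∧ q = [b] := Iff.rfl

theorem sem_castIso {a b : List V} (h : a = b) {p q : List α} :
    sem M (G.castIso h).hom p q ↔ p.length = a.length ∧ q = p :=
  Term.sem_cast h p q

theorem sem_pair {a b c : List V} (f : G.word a ⟶ G.word b) (g : G.word a ⟶ G.word c)
    {p q : List α} :
    sem M (pair f g) p q ↔ ∃ q₁ q₂, q = q₁ ++ q₂ ∧ sem M f p q₁ ∧ sem M g p q₂ := by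
  obtain ⟨f⟩ := f
  obtain ⟨g⟩ := g
  constructor
  · rintro ⟨_, ⟨h, rfl⟩, p₁, p₂, q₁, q₂, e, rfl, h₁, h₂⟩
    obtain ⟨rfl, rfl⟩ := List.append_inj e (h.trans (Term.sem_length _ h₁).1.symm)
    exact ⟨q₁, q₂, rfl, h₁, h₂⟩
  · rintro ⟨q₁, q₂, rfl, h₁, h₂⟩
    exact ⟨p ++ p, ⟨(Term.sem_length _ h₁).1, rfl⟩, p, p, q₁, q₂, rfl, rfl, h₁, h₂⟩

theorem sem_fst {a b : List V} {p₁ p₂ q : List α} (h₁ : p₁.length = a.length)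
    (h₂ : p₂.length = b.length) : sem M (fst (G.word a) (G.word b)) (p₁ ++ p₂) q ↔ q = p₁ := by
  rw [fst, sem_comp]
  constructor
  · rintro ⟨_, ⟨p₁', p₂', _, _, e, rfl, ⟨h₁', rfl⟩, h₂', rfl⟩, h⟩
    obtain ⟨rfl, rfl⟩ := List.append_inj e (h₁.trans h₁'.symm)
    exact (((sem_castIso _).1 h).2).trans (List.append_nil _)
  · rintro rfl
    exact ⟨q ++ [], ⟨q, p₂, q, [], rfl, rfl, ⟨h₁, rfl⟩, h₂, rfl⟩,
      (sem_castIso _).2 ⟨(congrArg List.length (List.append_nil q)).trans (h₁.trans (congrArg List.length (List.append_nil a).symm)), by simp⟩⟩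

theorem sem_snd {a b : List V} {p₁ p₂ q : List α} (h₁ : p₁.length = a.length)
    (h₂ : p₂.length = b.length) : sem M (snd (G.word a) (G.word b)) (p₁ ++ p₂) q ↔ q = p₂ := by
  rw [snd, sem_comp]
  constructor
  · rintro ⟨_, ⟨p₁', p₂', _, _, e, rfl, ⟨h₁', rfl⟩, h₂', rfl⟩, h⟩
    obtain ⟨rfl, rfl⟩ := List.append_inj e (h₁.trans h₁'.symm)
    exact ((sem_castIso _).1 h).2
  · rintro rfl
    exact ⟨[] ++ q, ⟨p₁, q, [], q, rfl, rfl, ⟨h₁, rfl⟩, h₂, rfl⟩,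
      (sem_castIso _).2 ⟨h₂, rfl⟩⟩

variable [DecidableEq V]

/-- Inputs of the form `s.map e` give equal values to equal letters, so it does not matter which
occurrence is selected and `s` need not be singular. -/
theorem sem_proj (e : V → α) : ∀ (s : List V) (x : V) (h : x ∈ s) {q : List α},
    sem M (G.proj s x h) (s.map e) q ↔ q = [e x]
  | y :: s, x, h, q => by
    by_cases hxy : x = y
    · subst hxy
      rw [proj_self]
      exact sem_fst (p₁ := [e x]) rfl (by simp)
    · have h' : x ∈ s := by simpa [hxy] using h
      rw [proj_of_ne G hxy s h h']
      refine (sem_comp _ _).trans ?_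
      have := fun r => sem_snd (G := G) (M := M) (a := [y]) (b := s) (p₁ := [e y]) (p₂ := s.map e)
        (q := r) rfl (by simp)
      simp only [List.map_cons, List.singleton_append] at this ⊢
      constructor
      · rintro ⟨r, hr, hq⟩
        rw [(this r).1 hr] at hq
        exact (sem_proj e s x h').1 hq
      · exact fun hq => ⟨_, (this _).2 rfl, (sem_proj e s x h').2 hq⟩

theorem sem_multiplier (e : V → α) (s : List V) : ∀ (w : List V) (h : ∀ x ∈ w, x ∈ s)
    {q : List α}, sem M (G.multiplier s w h) (s.map e) q ↔ q = w.map e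
  | [], h, q => sem_discard.trans (by simp)
  | x :: w, h, q => by
    rw [multiplier_cons]
    refine (sem_pair _ _).trans ?_
    simp [sem_proj, sem_multiplier e s w]

theorem sem_addMechanism (e : V → α) (s : List V) (x : V) (h : ∀ y ∈ G.pa x, y ∈ s) {q : List α} :
    sem M (G.addMechanism s x h) (s.map e) q ↔
      ∃ b, M.rel x ((G.pa x).map e) b ∧ q = b :: s.map e := by
  rw [addMechanism_eq]
  refine (sem_pair _ _).trans ?_
  simp only [sem_comp, sem_multiplier, sem_mechanism, sem_id]
  constructor
  · rintro ⟨q₁, q₂, rfl, ⟨r, rfl, -, b, hb, rfl⟩, -, rfl⟩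
    exact ⟨b, hb, rfl⟩
  · rintro ⟨b, hb, rfl⟩
    exact ⟨[b], s.map e, rfl, ⟨_, rfl, by simp, b, hb, rfl⟩, by simp, rfl⟩

/-- The possible outputs are the restrictions to `v` of the global valuations that extend the input
and satisfy every mechanism. Each vertex is assigned once, so no value is overwritten, and the order
of `l` leaves no trace. -/
theorem sem_run {v : List V} : ∀ {s l : List V} (e : V → α) (h : G.CanRun v s l), l.Nodup →
    (∀ x ∈ l, x ∉ s) → ∀ {q : List α}, sem M (G.run v s l h) (s.map e) q ↔
      ∃ e' : V → α, (∀ x ∈ s, e' x = e x) ∧ (∀ x ∈ l, M.rel x ((G.pa x).map e') (e' x)) ∧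
        q = v.map e'
  | s, [], e, h, _, _, q => by
    refine (sem_multiplier e s v h).trans ⟨?_, ?_⟩
    · rintro rfl
      exact ⟨e, fun _ _ => rfl, by simp, rfl⟩
    · rintro ⟨e', he, -, rfl⟩
      exact List.map_congr_left fun x hx => he x (h x hx)
  | s, x :: l, e, h, hn, hd, q => by
    rw [List.nodup_cons] at hn
    have hxs : x ∉ s := hd x (by simp)
    have hd' : ∀ y ∈ l, y ∉ x :: s := fun y hy hy' => by
      rcases List.mem_cons.1 hy' with rfl | hy'
      · exact hn.1 hy
      · exact hd y (by simp [hy]) hy'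
    have hup : ∀ b, ∀ y ∈ s, Function.update e x b y = e y := fun b y hy =>
      Function.update_of_ne (ne_of_mem_of_not_mem hy hxs) _ _
    have hmap : ∀ b, b :: s.map e = (x :: s).map (Function.update e x b) := fun b => by
      rw [List.map_cons, Function.update_self, List.map_congr_left (hup b)]
    rw [run, sem_comp]
    constructor
    · rintro ⟨r, hr, hq⟩
      obtain ⟨b, hb, rfl⟩ := (sem_addMechanism e s x h.1).1 hr
      rw [hmap, sem_run _ h.2 hn.2 hd'] at hq
      obtain ⟨e', he, hl, rfl⟩ := hq
      have hs : ∀ y ∈ s, e' y = e y := fun y hy =>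
        (he y (List.mem_cons_of_mem _ hy)).trans (hup b y hy)
      have hx : e' x = b := (he x (by simp)).trans (Function.update_self _ _ _)
      refine ⟨e', hs, ?_, rfl⟩
      intro y hy
      rcases List.mem_cons.1 hy with rfl | hy
      · rw [hx, List.map_congr_left fun z hz => hs z (h.1 z hz)]
        exact hb
      · exact hl y hy
    · rintro ⟨e', he, hl, rfl⟩
      have hb := hl x (by simp)
      rw [List.map_congr_left fun z hz => he z (h.1 z hz)] at hb
      refine ⟨_, (sem_addMechanism e s x h.1).2 ⟨e' x, hb, rfl⟩, ?_⟩
      rw [hmap, sem_run _ h.2 hn.2 hd']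
      refine ⟨e', ?_, fun y hy => hl y (by simp [hy]), rfl⟩
      intro y hy
      rcases List.mem_cons.1 hy with rfl | hy
      · rw [Function.update_self]
      · rw [hup _ y hy, he y hy]

end CausalGraph

/-! ### t-separation and common ancestors -/

namespace CausalGraph

open MarkovCategory

variable {V : Type u} {G : CausalGraph V}

variable (G) in
/-- There is a directed path, possibly trivial, from `x` to `y` that avoids `u` after its start. -/
def Reaches (u : List V) (x y : V) : Prop := Relation.ReflTransGen (fun a b => G.Adj a b ∧ b ∉ u) x y

variable (G) in
/-- `p` lists the vertices of a directed path, possibly trivial, from `x` to `y` avoiding `u`. -/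
def IsPathAvoiding (u : List V) (x y : V) (p : List V) : Prop :=
  p.IsChain G.Adj ∧ p.head? = some x ∧ p.getLast? = some y ∧ ∀ z ∈ p, z ∉ u

theorem IsPathAvoiding.isDirectedPath {u : List V} {x y : V} {p : List V}
    (h : G.IsPathAvoiding u x y p) (hxy : x ≠ y) : G.IsDirectedPath x y p := by
  obtain ⟨hc, hh, hl, -⟩ := h
  refine ⟨?_, hc, hh, hl⟩
  match p with
  | [] => simp at hh
  | [z] => simp_all
  | _ :: _ :: _ => simp

theorem Reaches.exists_path {u : List V} {x y : V} (h : G.Reaches u x y) (hx : x ∉ u) :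
    ∃ p, G.IsPathAvoiding u x y p := by
  induction h using Relation.ReflTransGen.head_induction_on with
  | refl => exact ⟨[y], by simp [IsPathAvoiding, hx]⟩
  | head h _ ih =>
    obtain ⟨p, hc, hh, hl, hu⟩ := ih h.2
    obtain ⟨l, rfl⟩ := List.head?_eq_some_iff.1 hh
    exact ⟨_ :: _ :: l, List.isChain_cons_cons.2 ⟨h.1, hc⟩, rfl, by simpa using hl,
      by simpa [hx] using hu⟩

theorem IsDirectedPath.reaches {u : List V} {x y : V} {p : List V} (h : G.IsDirectedPath x y p)
    (hu : ∀ z ∈ p, z ∉ u) : G.Reaches u x y := by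
  obtain ⟨-, hc, hh, hl⟩ := h
  induction p generalizing x with
  | nil => simp at hh
  | cons z p ih =>
    obtain rfl : z = x := by simpa using hh
    cases p with
    | nil =>
      obtain rfl : z = y := by simpa using hl
      exact .refl
    | cons z' p =>
      rw [List.isChain_cons_cons] at hc
      exact .head ⟨hc.1, hu z' (by simp)⟩
        (ih (fun t ht => hu t (by simp_all)) hc.2 rfl (by simpa using hl))

theorem IsDirectedPath.head_mem {x y : V} {p : List V} (h : G.IsDirectedPath x y p) : x ∈ p :=
  List.mem_of_mem_head? h.2.2.1

/-- Cutting at a vertex other than an endpoint shortens the path strictly; these inequalities drive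
the minimality argument in `tSeparated_iff`. -/
theorem IsPathAvoiding.split {u : List V} {x y z : V} {p : List V} (h : G.IsPathAvoiding u x y p)
    (hz : z ∈ p) : ∃ p₁ p₂, G.IsPathAvoiding u x z p₁ ∧ G.IsPathAvoiding u z y p₂ ∧
      (z ≠ x → p₂.length < p.length) ∧ (z ≠ y → p₁.length < p.length) := by
  obtain ⟨hc, hh, hl, hu⟩ := h
  obtain ⟨l₁, l₂, rfl⟩ := List.append_of_mem hz
  have hc' := List.isChain_append.1 hc
  refine ⟨l₁ ++ [z], z :: l₂, ⟨?_, ?_, by simp, fun t ht => hu t ?_⟩,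
    ⟨hc'.2.1, rfl, ?_, fun t ht => hu t (by simp_all)⟩, fun hx => ?_, fun hy => ?_⟩
  · rw [show l₁ ++ z :: l₂ = (l₁ ++ [z]) ++ l₂ by simp, List.isChain_append] at hc
    exact hc.1
  · cases l₁ <;> simpa using hh
  · simp only [List.mem_append, List.mem_cons] at ht ⊢
    tauto
  · simpa [List.getLast?_append] using hl
  · cases l₁ with
    | nil => simp at hh; exact absurd hh hx
    | cons _ _ => simp
  · cases l₂ with
    | nil => simp at hl; exact absurd hl hy
    | cons _ _ => simp

/-- An unblocked trek has a common source: its start, its end or its fork. Conversely, take two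
paths to `v` and `w` from a common source with least total length; any further vertex of `v` or `w`
on them, or a second common vertex, would allow a shorter choice. -/
theorem tSeparated_iff {u v w : List V} (huv : u.Disjoint v) (huw : u.Disjoint w)
    (hvw : v.Disjoint w) : G.TSeparated {x | x ∈ v} {x | x ∈ w} {x | x ∈ u} ↔
      ∀ x ∉ u, (∃ a ∈ v, G.Reaches u x a) → ¬ ∃ b ∈ w, G.Reaches u x b := by
  constructor
  · rintro ⟨hf, hb⟩ x hx ⟨a, ha, hxa⟩ ⟨b, hb', hxb⟩
    let P : ℕ → Prop := fun n => ∃ x a b p q, a ∈ v ∧ b ∈ w ∧ G.IsPathAvoiding u x a p ∧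
      G.IsPathAvoiding u x b q ∧ n = p.length + q.length
    have hP : ∃ n, P n := by
      obtain ⟨p, hp⟩ := hxa.exists_path hx
      obtain ⟨q, hq⟩ := hxb.exists_path hx
      exact ⟨_, x, a, b, p, q, ha, hb', hp, hq, rfl⟩
    classical
    obtain ⟨x, a, b, p, q, ha, hb', hp, hq, hn⟩ := Nat.find_spec hP
    have hmin : ∀ x' a' b' p' q', a' ∈ v → b' ∈ w → G.IsPathAvoiding u x' a' p' →
        G.IsPathAvoiding u x' b' q' → p.length + q.length ≤ p'.length + q'.length :=
      fun x' a' b' p' q' h₁ h₂ h₃ h₄ =>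
        hn ▸ Nat.find_min' hP ⟨x', a', b', p', q', h₁, h₂, h₃, h₄, rfl⟩
    have hxp : x ∈ p := List.mem_of_mem_head? hp.2.1
    have hxq : x ∈ q := List.mem_of_mem_head? hq.2.1
    have hp0 : 1 ≤ p.length := List.length_pos_of_mem hxp
    have hq0 : 1 ≤ q.length := List.length_pos_of_mem hxq
    have hsing : ∀ z, z ∉ u → G.IsPathAvoiding u z z [z] := fun z hz => by
      simp [IsPathAvoiding, hz]
    have hpv : ∀ y ∈ p, y ∈ v → y = a := fun y hy hyv => by
      by_contra hne
      obtain ⟨p₁, p₂, h₁, -, -, h⟩ := hp.split hy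
      have := hmin x y b p₁ q hyv hb' h₁ hq
      have := h hne
      omega
    have hqw : ∀ y ∈ q, y ∈ w → y = b := fun y hy hyw => by
      by_contra hne
      obtain ⟨q₁, q₂, h₁, -, -, h⟩ := hq.split hy
      have := hmin x a y p q₁ ha hyw hp h₁
      have := h hne
      omega
    have hpw : ∀ y ∈ p, y ∈ w → y = x := fun y hy hyw => by
      by_contra hne
      obtain ⟨p₁, p₂, -, h₁, h, -⟩ := hp.split hy
      have := hmin y a y p₂ [y] ha hyw h₁ (hsing y (hp.2.2.2 y hy))
      have := h hne
      simp at *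
      omega
    have hqv : ∀ y ∈ q, y ∈ v → y = x := fun y hy hyv => by
      by_contra hne
      obtain ⟨q₁, q₂, -, h₁, h, -⟩ := hq.split hy
      have := hmin y y b [y] q₂ hyv hb' (hsing y (hq.2.2.2 y hy)) h₁
      have := h hne
      simp at *
      omega
    have hpq : ∀ y ∈ p, y ∈ q → y = x := fun y hy hy' => by
      by_contra hne
      obtain ⟨p₁, p₂, -, h₁, h, -⟩ := hp.split hy
      obtain ⟨q₁, q₂, -, h₁', h', -⟩ := hq.split hy'
      have := hmin y a b p₂ q₂ ha hb' h₁ h₁'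
      have := h hne
      have := h' hne
      omega
    have hab : a ≠ b := fun h => hvw ha (h ▸ hb')
    -- The position of the source `x` decides the shape of the trek: in `v` it gives a forward trek
    -- along `q`, in `w` a backward directed path along `p`, and otherwise a fork.
    by_cases hxv : x ∈ v
    · obtain rfl := hpv x hxp hxv
      obtain ⟨k, hk, hku⟩ := hf x b {z | z ∈ q} ⟨hab, q, hq.isDirectedPath hab, rfl⟩
        ⟨ha, hb', fun y hy hyv => hyv.imp (hqv y hy) (hqw y hy)⟩
      exact hq.2.2.2 k hk hku
    by_cases hxw : x ∈ w
    · obtain rfl := hqw x hxq hxw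
      obtain ⟨k, hk, hku⟩ := hb a x {z | z ∈ p} ⟨hab, .inl ⟨p, hp.isDirectedPath hab.symm, rfl⟩⟩
        ⟨ha, hb', fun y hy hyv => hyv.imp (hpv y hy) (hpw y hy)⟩
      exact hp.2.2.2 k hk hku
    have hxa : x ≠ a := fun h => hxv (h ▸ ha)
    have hxb : x ≠ b := fun h => hxw (h ▸ hb')
    obtain ⟨k, hk, hku⟩ := hb a b {z | z ∈ p ∨ z ∈ q} ⟨hab, .inr ⟨x, p, q, hxa, hxb,
      hp.isDirectedPath hxa, hq.isDirectedPath hxb, hpq, rfl⟩⟩ ⟨ha, hb', by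
        rintro y (hy | hy) (hyv | hyw)
        · exact .inl (hpv y hy hyv)
        · exact absurd (hpw y hy hyw ▸ hyw) hxw
        · exact absurd (hqv y hy hyv ▸ hyv) hxv
        · exact .inr (hqw y hy hyw)⟩
    rcases hk with hk | hk
    · exact hp.2.2.2 k hk hku
    · exact hq.2.2.2 k hk hku
  · intro h
    constructor
    · rintro i j S ⟨-, p, hp, rfl⟩ ⟨hi, hj, -⟩
      by_contra hu
      push Not at hu
      exact h i (fun hiu => huv hiu hi) ⟨i, hi, .refl⟩ ⟨j, hj, hp.reaches hu⟩
    · rintro i j S ⟨-, ⟨p, hp, rfl⟩ | ⟨k, p, q, -, -, hp, hq, -, rfl⟩⟩ ⟨hi, hj, -⟩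
      · by_contra hu
        push Not at hu
        exact h j (fun hju => huw hju hj) ⟨i, hi, hp.reaches hu⟩ ⟨j, hj, .refl⟩
      · by_contra hu
        push Not at hu
        exact h k (hu k (.inl hp.head_mem)) ⟨i, hi, hp.reaches fun z hz => hu z (.inl hz)⟩
          ⟨j, hj, hq.reaches fun z hz => hu z (.inr hz)⟩

/-! ### Conditional independence over runs -/

theorem CanRun.parent_mem {v : List V} : ∀ {s l : List V}, G.CanRun v s l → ∀ x ∈ l,
    ∀ y ∈ G.pa x, y ∈ s ∨ y ∈ l
  | s, z :: l, h, x, hx, y, hy => by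
    rcases List.mem_cons.1 hx with rfl | hx
    · exact .inl (h.1 y hy)
    · have := CanRun.parent_mem h.2 x hx y hy
      simp only [List.mem_cons] at this ⊢
      tauto

theorem CanRun.target_mem {v : List V} : ∀ {s l : List V}, G.CanRun v s l → ∀ x ∈ v,
    x ∈ s ∨ x ∈ l
  | s, [], h, x, hx => .inl (h x hx)
  | s, z :: l, h, x, hx => by
    have := CanRun.target_mem h.2 x hx
    simp only [List.mem_cons] at this ⊢
    tauto

open Classical in
/-- The model in which the value of `x` is arbitrary and every other vertex takes the disjunction
of the values of its parents. -/
noncomputable def sourceModel (x : V) : Model V Bool where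
  rel y p b := y ≠ x → b = decide (true ∈ p)
  total _ p := ⟨decide (true ∈ p), fun _ => rfl⟩

/-- For relations, conditional independence means that two outputs for the same input can be
recombined: the `v`-part of one with the `w`-part of the other. -/
theorem sem_of_condIndep {α : Type*} {M : Model V α} {u v w : List V}
    {f : G.word u ⟶ G.word v ⊗ G.word w} (hf : CondIndep f) {p q₁ q₂ r₁ r₂ : List α}
    (hq : sem M f p (q₁ ++ q₂)) (hr : sem M f p (r₁ ++ r₂)) (hq₁ : q₁.length = v.length)
    (hq₂ : q₂.length = w.length) (hr₁ : r₁.length = v.length) (hr₂ : r₂.length = w.length) :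
    sem M f p (q₁ ++ r₂) := by
  have e : f = pair (f ≫ fst (G.word v) (G.word w)) (f ≫ snd (G.word v) (G.word w)) := hf
  rw [e]
  exact (sem_pair _ _).2 ⟨q₁, r₂, rfl, (sem_comp _ _).2 ⟨_, hq, (sem_fst hq₁ hq₂).2 rfl⟩,
    (sem_comp _ _).2 ⟨_, hr, (sem_snd hr₁ hr₂).2 rfl⟩⟩

variable [DecidableEq V]

theorem not_condIndep_run [Finite V] {u v w l : List V} (h : G.CanRun (v ++ w) u l) (hn : l.Nodup)
    (hd : ∀ x ∈ l, x ∉ u) (huv : u.Disjoint v) (huw : u.Disjoint w) {x a b : V} (hx : x ∉ u)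
    (ha : a ∈ v) (hxa : G.Reaches u x a) (hb : b ∈ w) (hxb : G.Reaches u x b) :
    ¬ CondIndep (X := G.word v) (Y := G.word w) (G.run (v ++ w) u l h) := by
  classical
  intro hf
  let M := sourceModel x
  -- Two valuations admitted by `sourceModel x` that agree on `u`: nothing happens, or `x` is
  -- switched on and exactly the vertices it reaches follow.
  let e₀ : V → Bool := fun _ => false
  let e₁ : V → Bool := fun z => decide (G.Reaches u x z)
  have hsem : ∀ q : List Bool, sem M (G.run (v ++ w) u l h) (u.map e₀) q ↔ _ := fun q =>
    sem_run e₀ h hn hd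
  have h₀ : sem M (G.run (v ++ w) u l h) (u.map e₀) (v.map e₀ ++ w.map e₀) := by
    rw [hsem]
    refine ⟨e₀, fun _ _ => rfl, fun y _ _ => ?_, List.map_append.symm⟩
    simp [e₀]
  have h₁ : sem M (G.run (v ++ w) u l h) (u.map e₀) (v.map e₁ ++ w.map e₁) := by
    rw [hsem]
    refine ⟨e₁, fun y hy => ?_, fun y hy hyx => ?_, List.map_append.symm⟩
    · refine decide_eq_false fun hxy => ?_
      rcases hxy.cases_tail with rfl | ⟨z, -, -, hz⟩
      · exact hx hy
      · exact hz hy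
    · refine decide_eq_decide.2 ?_
      simp only [List.mem_map, e₁, decide_eq_true_eq]
      constructor
      · intro hxy
        rcases hxy.cases_tail with rfl | ⟨z, hz, hzy, -⟩
        · exact absurd rfl hyx
        · exact ⟨z, G.mem_pa.2 hzy, hz⟩
      · rintro ⟨z, hz, hxz⟩
        exact hxz.tail ⟨G.mem_pa.1 hz, hd y hy⟩
  -- Recombined output: `e₁` on `v`, where `a` is `true`, and `e₀` on `w`, where `b` is `false`.
  have key := sem_of_condIndep (M := M) hf h₁ h₀ (by simp) (by simp) (by simp) (by simp)
  obtain ⟨e, heu, hel, he⟩ := (hsem _).1 key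
  rw [List.map_append] at he
  obtain ⟨hev, hew⟩ := List.append_inj he (by simp)
  have hea : e a = true := by
    rw [← List.map_inj_left.1 hev a ha]
    exact decide_eq_true hxa
  have heb : e b = false := (List.map_inj_left.1 hew b hb).symm
  have hbu : b ∈ l := (h.target_mem b (by simp [hb])).resolve_left fun h => huw h hb
  have hex : e x = false := by
    -- Backwards along a path to `b`: a disjunction that is `false` has only `false` parents. The
    -- rule is not available at `x`, and the second alternative covers a path that has already met
    -- `x`.
    have : ∀ z, G.Reaches u z b → z ∉ u → z ∈ l ∧ (e z = false ∨ e x = false) := by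
      intro z hz
      induction hz using Relation.ReflTransGen.head_induction_on with
      | refl => exact fun _ => ⟨hbu, .inl heb⟩
      | @head z z' hzz' _ ih =>
        intro hzu
        obtain ⟨hl, hz'⟩ := ih hzz'.2
        have hpa := G.mem_pa.2 hzz'.1
        refine ⟨(h.parent_mem z' hl z hpa).resolve_left hzu, ?_⟩
        by_cases hzx : z' = x
        · subst hzx
          exact .inr (hz'.elim id id)
        · refine hz'.imp_left fun hz' => ?_
          rw [hel z' hl hzx, decide_eq_false_iff_not] at hz'
          by_contra hne
          exact hz' (List.mem_map.2 ⟨z, hpa, by simpa using hne⟩)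
    exact (this x hxb hx).2.elim id id
  let r : V → V → Prop := Relation.TransGen G.Adj
  have : IsTrans V r := ⟨fun _ _ _ => .trans⟩
  have : Std.Irrefl r := ⟨G.acyclic⟩
  -- With `u` and `x` all `false` no source of `true` remains, and induction along ancestors makes
  -- every vertex of `l` `false`, including `a`.
  have hfalse : ∀ y, y ∈ l → e y = false := by
    intro y
    induction y using (Finite.wellFounded_of_trans_of_irrefl r).induction with
    | _ y ih =>
      intro hy
      by_cases hyx : y = x
      · rw [hyx, hex]
      · rw [hel y hy hyx, decide_eq_false_iff_not, List.mem_map]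
        rintro ⟨z, hz, hez⟩
        rcases h.parent_mem y hy z hz with hzu | hzl
        · simp [heu z hzu, e₀] at hez
        · simp [ih z (.single (G.mem_pa.1 hz)) hzl] at hez
  have hal : a ∈ l := (h.target_mem a (by simp [ha])).resolve_left fun h => huv h ha
  simp [hfalse a hal] at hea

theorem condIndep_run {u v w l : List V} (h : G.CanRun (v ++ w) u l) (hu : u.Nodup) (hn : l.Nodup)
    (hd : ∀ x ∈ l, x ∉ u)
    (hvw : ∀ x ∉ u, (∃ a ∈ v, G.Reaches u x a) → ¬ ∃ b ∈ w, G.Reaches u x b) :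
    CondIndep (X := G.word v) (Y := G.word w) (G.run (v ++ w) u l h) := by
  have hcl : ∀ t : List V, ∀ x ∈ l, (∃ a ∈ t, G.Reaches u x a) → ∀ y ∈ G.pa x,
      ∃ a ∈ t, G.Reaches u y a := fun t x hx ⟨a, ha, hxa⟩ y hy =>
    ⟨a, ha, .head ⟨G.mem_pa.1 hy, hd x hx⟩ hxa⟩
  exact condIndep_of_eq_pair (run_append_eq_pair (A := {x | ∃ a ∈ v, G.Reaches u x a})
    (B := {x | ∃ b ∈ w, G.Reaches u x b}) (fun x hx => ⟨x, hx, .refl⟩) (fun x hx => ⟨x, hx, .refl⟩)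
    h hu hn hd (hcl v) (hcl w) fun x hx => hvw x (hd x hx))

end CausalGraph

/-! ### Conditional independence over causal effects and t-separation -/

theorem mainTheorem3 {V : Type*} [Finite V] [DecidableEq V] (G : CausalGraph V)
    (u v w : List V) (hu : u.Nodup) (hv : v.Nodup) (hw : w.Nodup)
    (huv : u.Disjoint v) (huw : u.Disjoint w) (hvw : v.Disjoint w) :
    CondIndep (X := G.word v) (Y := G.word w) (G.causalEffect u (v ++ w)) ↔
      G.TSeparated {x | x ∈ v} {x | x ∈ w} {x | x ∈ u} := by
  -- The order of the mechanisms is chosen arbitrarily. Both directions use only that it is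
  -- runnable, repeats no vertex and avoids `u`.
  obtain ⟨hn, hl, h⟩ := (G.exists_effect_order u (v ++ w)).choose_spec
  have hd := fun x hx => ((hl x).1 hx).2
  rw [CausalGraph.tSeparated_iff huv huw hvw]
  constructor
  · rintro hf x hx ⟨a, ha, hxa⟩ ⟨b, hb, hxb⟩
    exact CausalGraph.not_condIndep_run h hn hd huv huw hx ha hxa hb hxb hf
  · exact CausalGraph.condIndep_run h hu hn hd
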